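/- Let $n\ge 1$. A pointed partition of $[n]=\{1,\dots,n\}$ is a set partition of $[n]$ together with the choice of one element (the pointed element) in each block. Let $\Pi^A_n$ be the poset of pointed partitions of $[n]$, where $\pi\le\nu$ if the partition underlying $\pi$ refines that of $\nu$ and the set of pointed elements of $\pi$ contains that of $\nu$. Let $\widehat{\Pi}^A_n$ be the bounded poset obtained from $\Pi^A_n$ by adding a maximal element $\hat 1$ (with $\hat 0$ its least element). Then: (1) $\widehat{\Pi}^A_n$ is totally semi-modular: in each closed interval, any two distinct elements covering a common element are covered by a common element. (2) $\widehat{\Pi}^A_n$ is CL-shellable: it is graded (all maximal chains of each interval have the same length) and admits a CL-labeling. (3) Let $\mathbb K$ be the ring $\mathbb Z$ or any field. Then $\widehat{\Pi}^A_n$ is Cohen–Macaulay over $\mathbb K$: for all $x<y$ the reduced homology with coefficients in $\mathbb K$ of the order complex of the open interval $(x,y)$ vanishes in all dimensions except the dimension of this complex. In particular the homology of $\widehat{\Pi}^A_n$, that is, the reduced homology of the order complex of $(\hat 0,\hat 1)$, which has dimension $n-2$, is concentrated in dimension $n-2$, and $\widetilde H_{n-2}$ is a free $\mathbb K$-module of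 rank $(n-1)^{n-1}$ (with $0^0=1$; for $n=1$ this is the homology, in dimension $-1$, of the empty complex). (4) The Möbius number of $\widehat{\Pi}^A_n$ is $\mu(\hat 0,\hat 1)=-\chi^A_n(1)$, where $\chi^A_n(x)=\sum_{\pi\in\Pi^A_n}\mu(\hat 0,\pi)\,x^{\,n-1-\operatorname{rk}(\pi)}$ is the characteristic polynomial of $\Pi^A_n$, and the rank of the homology is computed by it: $(n-1)^{n-1}=(-1)^n\mu(\hat 0,\hat 1)$. -/

import Mathlib

/-! ### Pointed partitions -/

/-- A pointed partition of `[n]` (modelled by `Fin n`): a partition of `[n]`, given by its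
equivalence relation `part`, together with the choice of one element inside each block.
The set of chosen (pointed) elements is `points`; it meets every block in exactly one element. -/
@[ext]
structure PointedPartition (n : ℕ) where
  part : Setoid (Fin n)
  points : Set (Fin n)
  existsUnique_point : ∀ x : Fin n, ∃! p : Fin n, p ∈ points ∧ part p x

namespace PointedPartition

variable {n : ℕ}

/-- `π ≤ ν` if the partition of `π` is finer than the one of `ν` and the pointed elements of `π`
contain those of `ν`. -/
instance : PartialOrder (PointedPartition n) where
  le π ν := π.part ≤ ν.part ∧ ν.points ⊆ π.points
  le_refl π := ⟨le_refl _, subset_rfl⟩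
  le_trans _ _ _ h₁ h₂ := ⟨h₁.1.trans h₂.1, h₂.2.trans h₁.2⟩
  le_antisymm _ _ h₁ h₂ :=
    PointedPartition.ext (le_antisymm h₁.1 h₂.1) (Set.Subset.antisymm h₂.2 h₁.2)

/-- The least pointed partition: all blocks are singletons and every element is pointed. -/
instance : OrderBot (PointedPartition n) where
  bot :=
    { part := ⊥
      points := Set.univ
      existsUnique_point := fun x => ⟨x, ⟨Set.mem_univ x, rfl⟩, fun _ h => h.2⟩ }
  bot_le _ := ⟨bot_le, Set.subset_univ _⟩

instance : Finite (PointedPartition n) := by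
  refine Finite.of_injective
    (fun π : PointedPartition n => ((fun x y => π.part x y : Fin n → Fin n → Prop), π.points)) ?_
  intro π ν h
  have h₁ := congrArg Prod.fst h
  have h₂ := congrArg Prod.snd h
  exact PointedPartition.ext (Setoid.ext fun x y => iff_of_eq (congrFun (congrFun h₁ x) y)) h₂

end PointedPartition

/-- The bounded poset obtained from the poset of pointed partitions of `[n]` by adding a
maximal element. -/
abbrev ExtendedPointedPartition (n : ℕ) : Type := WithTop (PointedPartition n)

/-! ### Notions for finite posets -/

namespace FinPoset

/-- Semi-modularity: two distinct elements covering a common element are covered by a common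
element. -/
def IsSemimodular (α : Type*) [PartialOrder α] : Prop :=
  ∀ t u v : α, t ⋖ u → t ⋖ v → u ≠ v → ∃ z : α, u ⋖ z ∧ v ⋖ z

/-- A bounded poset is totally semi-modular if all its closed intervals are semi-modular. -/
def IsTotallySemimodular (α : Type*) [PartialOrder α] [BoundedOrder α] : Prop :=
  ∀ x y : α, x ≤ y → IsSemimodular (Set.Icc x y)

/-- The list `c = [x₀, …, xₖ]` is an unrefinable chain `x = x₀ ⋖ x₁ ⋖ ⋯ ⋖ xₖ = y`,
that is, a maximal chain of the interval `[x, y]`. -/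
def IsSaturatedChain {α : Type*} [PartialOrder α] (x y : α) (c : List α) : Prop :=
  c.IsChain (· ⋖ ·) ∧ c.head? = some x ∧ c.getLast? = some y

/-- A poset is pure if for all `x ≤ y` all maximal chains of `[x, y]` have the same length. -/
def IsPure (α : Type*) [PartialOrder α] : Prop :=
  ∀ (x y : α) (c c' : List α), IsSaturatedChain x y c → IsSaturatedChain x y c' →
    c.length = c'.length

section CL

variable {α : Type*} [PartialOrder α] [BoundedOrder α] {Λ : Type*}

/-- `lab m i` is the label of the `i`-th edge `xᵢ ⋖ xᵢ₊₁` of the maximal chain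
`m = [x₀, x₁, …]` of `α`. It is a chain-edge labeling if, whenever two maximal chains coincide
along their first `d` edges, their labels coincide along these edges. -/
def IsChainEdgeLabeling (lab : List α → ℕ → Λ) : Prop :=
  ∀ m m' : List α, IsSaturatedChain ⊥ ⊤ m → IsSaturatedChain ⊥ ⊤ m' →
    ∀ d : ℕ, m.take (d + 1) = m'.take (d + 1) → ∀ i < d, lab m i = lab m' i

/-- The sequence of labels of the edges of a maximal chain `c` of `[x, y]`, where `r` is a
saturated chain from `⊥` to `x` (the root), computed in the maximal chain of `α` that is obtained
by following `r`, then `c`, and then a saturated chain `t` from `y` to `⊤`. (For a chain-edge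
labeling it does not depend on `t`.) -/
def labelSeq (lab : List α → ℕ → Λ) (r c t : List α) : List Λ :=
  (List.range' (r.length - 1) (c.length - 1)).map (lab (r ++ c.tail ++ t.tail))

/-- A CL-labeling (chain lexicographic labeling): a chain-edge labeling such that in each rooted
interval `[x, y]_r` there is a unique maximal chain with (weakly) increasing labels, and the label
sequence of this chain lexicographically precedes those of all other maximal chains. -/
def IsCLLabeling [PartialOrder Λ] (lab : List α → ℕ → Λ) : Prop :=
  IsChainEdgeLabeling lab ∧
    ∀ (x y : α) (r t : List α), x ≤ y → IsSaturatedChain ⊥ x r → IsSaturatedChain y ⊤ t →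
      ∃ c : List α, IsSaturatedChain x y c ∧ (labelSeq lab r c t).IsChain (· ≤ ·) ∧
        ∀ c' : List α, IsSaturatedChain x y c' → c' ≠ c →
          ¬ (labelSeq lab r c' t).IsChain (· ≤ ·) ∧
            List.Lex (· < ·) (labelSeq lab r c t) (labelSeq lab r c' t)

variable (α) in
/-- A bounded poset is CL-shellable if it is graded (bounded and pure) and admits a CL-labeling
with values in some poset `Λ`. -/
def IsCLShellable : Prop :=
  IsPure α ∧ ∃ (Λ : Type) (_ : PartialOrder Λ) (lab : List α → ℕ → Λ), IsCLLabeling lab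

end CL

/-! ### Homology -/

section Homology

open CategoryTheory

universe u v

variable (K : Type u) [CommRing K] (α : Type v) [PartialOrder α]

/-- The boundary map of the augmented simplicial chain complex of the order complex of `α`: a chain
`x₀ < ⋯ < xₖ` is sent to `∑ i, (-1) ^ i • (x₀ < ⋯ x̂ᵢ ⋯ < xₖ)`. Chains with `k` elements are
encoded as order embeddings `Fin k ↪o α`. -/
noncomputable def boundary (k : ℕ) : ((Fin (k + 1) ↪o α) →₀ K) →ₗ[K] ((Fin k ↪o α) →₀ K) :=
  Finsupp.lift _ K _ fun c => ∑ i : Fin (k + 1),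
    Finsupp.single ((Fin.succAboveOrderEmb i).trans c) ((-1 : K) ^ (i : ℕ))

theorem boundary_single (k : ℕ) (c : Fin (k + 1) ↪o α) (a : K) :
    boundary K α k (Finsupp.single c a) = ∑ i : Fin (k + 1),
      Finsupp.single ((Fin.succAboveOrderEmb i).trans c) (a * (-1 : K) ^ (i : ℕ)) := by
  simp [boundary, Finset.smul_sum]

theorem boundary_comp_boundary (k : ℕ) : boundary K α k ∘ₗ boundary K α (k + 1) = 0 := by
  refine Finsupp.lhom_ext' fun c => LinearMap.ext_ring ?_
  simp only [LinearMap.comp_apply, Finsupp.lsingle_apply, boundary_single, map_sum,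
    LinearMap.zero_apply, LinearMap.zero_comp, one_mul]
  rw [← Finset.sum_product']
  refine Finset.sum_ninvolution
    (fun p : Fin (k + 2) × Fin (k + 1) => (p.1.succAbove p.2, p.2.predAbove p.1)) ?_ ?_ ?_ ?_
  · rintro ⟨i, j⟩
    have h : (Fin.succAboveOrderEmb (j.predAbove i)).trans
        ((Fin.succAboveOrderEmb (i.succAbove j)).trans c) =
        (Fin.succAboveOrderEmb j).trans ((Fin.succAboveOrderEmb i).trans c) := by
      ext x
      simp [Fin.succAbove_succAbove_succAbove_predAbove]
    simp only [h, ← Finsupp.single_add, ← pow_add, Fin.neg_one_pow_succAbove_add_predAbove]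
    simp
  · rintro ⟨i, j⟩ - h
    exact Fin.succAbove_ne i j (congrArg Prod.fst h)
  · simp
  · rintro ⟨i, j⟩
    simp [Fin.succAbove_succAbove_predAbove, Fin.predAbove_predAbove_succAbove]

/-- The augmented chain complex of the order complex of `α` with coefficients in `K`, in which the
chains with `k` elements (the simplices of dimension `k - 1`) sit in degree `k`; the empty chain
spans degree `0`. -/
noncomputable def augmentedChainComplex : ChainComplex (ModuleCat.{max u v} K) ℕ :=
  ChainComplex.of (fun k => ModuleCat.of K ((Fin k ↪o α) →₀ K))
    (fun k => ModuleCat.ofHom (boundary K α k))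
    (fun k => by
      rw [← ModuleCat.ofHom_comp, boundary_comp_boundary]
      rfl)

/-- The reduced homology group of the order complex of `α` in dimension `k - 1`. -/
noncomputable abbrev reducedHomologyPred (k : ℕ) : ModuleCat.{max u v} K :=
  (augmentedChainComplex K α).homology k

/-- A bounded poset is Cohen-Macaulay over `K` if the reduced homology of the order complex of each
open interval `(x, y)`, `x < y`, vanishes in all dimensions but the dimension of this complex.
As degrees are shifted by one, the latter is the maximal number of elements of a chain
in `(x, y)`. -/
def IsCohenMacaulay [BoundedOrder α] : Prop :=
  ∀ x y : α, x < y → ∀ k : ℕ, (k : ℕ∞) ≠ (Set.Ioo x y).chainHeight (· ≤ ·) →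
    Subsingleton (reducedHomologyPred K (Set.Ioo x y) k)

end Homology

/-! ### Möbius function and characteristic polynomial -/

section Moebius

variable (α : Type*) [PartialOrder α] [Finite α]

open Classical in
/-- The Möbius function of a finite poset. -/
noncomputable def moebius (x y : α) : ℤ :=
  letI : Fintype α := Fintype.ofFinite α
  letI : LocallyFiniteOrder α := Fintype.toLocallyFiniteOrder
  IncidenceAlgebra.mu ℤ x y

/-- The rank of an element of a ranked poset: the length of the chains below it. -/
noncomputable def rk {α : Type*} [PartialOrder α] (a : α) : ℕ := (Order.height a).toNat

/-- The characteristic polynomial `∑ a, μ(⊥, a) X ^ (N - rk a)` of a finite ranked poset, where `N`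
is the rank of its maximal elements. -/
noncomputable def charPoly [OrderBot α] : Polynomial ℤ :=
  letI : Fintype α := Fintype.ofFinite α
  ∑ a : α, Polynomial.C (moebius α ⊥ a) * Polynomial.X ^ ((⨆ b : α, rk b) - rk a)

end Moebius

end FinPoset

/-!
A pointed partition `π` of `[n]` is the same thing as an idempotent map `π.point` of `[n]`, which
sends every element to the point of its block, and the order becomes the natural order of
idempotents (`PointedPartition.le_iff_point`). A covering step absorbs one point into another one
(`PointedPartition.exists_covBy_eq_absorb`), so the number of points is a rank function. If two steps
from `π` absorb `b` into `a` and `d` into `c`, below a common upper bound, then two of these four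
points can be dropped at once below that bound; this is total semi-modularity
(`PointedPartition.exists_covBy_covBy_le`, `ExtendedPointedPartition.isTotallySemimodular`).

The other structural statements hold for every finite graded totally semi-modular poset.

* CL-shellability (`IsTotallySemimodular.isCLShellable`). The edges out of the end `a` of a saturated
  chain `… ⋖ x ⋖ a` are labelled by distinct integers, below the label of `x ⋖ a` if they lead to an
  element above an atom over `x` with a smaller label than `a`, and above it otherwise. By
  semi-modularity an increasing chain has to follow the smallest label all the time.
* The Cohen–Macaulay property (`IsTotallySemimodular.exactIn_above_atoms`). The open interval `(x, y)`
  is built from the cones `[a, y)` over its atoms `a`. Each new cone meets the union of the previous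
  ones in a subset of `(a, y)` which is again generated by atoms, so that a Mayer–Vietoris argument and
  induction on the length apply.

The top homology is the module of top cycles, hence free over a principal ideal domain, and its rank
is given by the Euler characteristic, which is the Möbius number by Philip Hall's theorem
(`sum_card_chain_eq_neg_moebius`). Finally, if `π` has `k` points, then
`μ(π, ⊤) = (-1) ^ k * (k - 1) ^ (k - 1)` (`ExtendedPointedPartition.moebius_coe_top`): above `π` there
are `k.choose j * j ^ (k - j)` pointed partitions with `j` points, so the recursion of the Möbius
function is an instance of Abel's binomial identity (`sum_choose_mul_pow_mul_pow`).
-/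

/-! ### Pointed partitions as idempotent maps -/

namespace PointedPartition

variable {n : ℕ}

/-- The pointed element of the block of `x`. The map `π.point` is idempotent, and it determines
`π`: two elements are in the same block if they have the same image, and the pointed elements are
the fixed points. -/
noncomputable def point (π : PointedPartition n) (x : Fin n) : Fin n :=
  (π.existsUnique_point x).choose

theorem point_mem (π : PointedPartition n) (x : Fin n) : π.point x ∈ π.points :=
  (π.existsUnique_point x).choose_spec.1.1

theorem part_point (π : PointedPartition n) (x : Fin n) : π.part (π.point x) x :=
  (π.existsUnique_point x).choose_spec.1.2

theorem eq_point (π : PointedPartition n) {x p : Fin n} (hp : p ∈ π.points) (h : π.part p x) :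
    p = π.point x :=
  (π.existsUnique_point x).unique ⟨hp, h⟩ ⟨π.point_mem x, π.part_point x⟩

theorem point_eq_self_iff (π : PointedPartition n) {x : Fin n} :
    π.point x = x ↔ x ∈ π.points :=
  ⟨fun h => h ▸ π.point_mem x, fun h => (π.eq_point h (π.part.refl x)).symm⟩

@[simp]
theorem point_point (π : PointedPartition n) (x : Fin n) : π.point (π.point x) = π.point x :=
  π.point_eq_self_iff.2 (π.point_mem x)

theorem part_iff (π : PointedPartition n) {x y : Fin n} :
    π.part x y ↔ π.point x = π.point y := by
  constructor
  · exact fun h => π.eq_point (π.point_mem x) (π.part.trans (π.part_point x) h)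
  · exact fun h => π.part.trans (π.part.symm (π.part_point x)) (h ▸ π.part_point y)

theorem ext_point {π ν : PointedPartition n} (h : ∀ x, π.point x = ν.point x) : π = ν := by
  refine PointedPartition.ext (Setoid.ext fun x y => ?_) (Set.ext fun x => ?_)
  · rw [part_iff, part_iff, h, h]
  · rw [← point_eq_self_iff, ← point_eq_self_iff, h]

/-- The order on pointed partitions is the natural order `g * f = f * g = g` of idempotent maps. -/
theorem le_iff_point {π ν : PointedPartition n} :
    π ≤ ν ↔ ∀ x, ν.point (π.point x) = ν.point x ∧ π.point (ν.point x) = ν.point x := by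
  constructor
  · exact fun h x => ⟨ν.part_iff.1 (h.1 (π.part_point x)),
      π.point_eq_self_iff.2 (h.2 (ν.point_mem x))⟩
  · refine fun h => ⟨fun {x y} hxy => ?_, fun x hx => ?_⟩
    · rw [part_iff] at hxy ⊢
      rw [← (h x).1, hxy, (h y).1]
    · rw [← point_eq_self_iff] at hx ⊢
      rw [← hx, (h x).2]

/-- The pointed partition given by an idempotent map. -/
def ofIdempotent (f : Fin n → Fin n) (hf : ∀ x, f (f x) = f x) : PointedPartition n where
  part := Setoid.ker f
  points := {x | f x = x}
  existsUnique_point x := ⟨f x, ⟨hf x, hf x⟩, fun p hp => by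
    rw [← (hp.1 : f p = p)]
    exact hp.2⟩

@[simp]
theorem point_ofIdempotent (f : Fin n → Fin n) (hf : ∀ x, f (f x) = f x) (x : Fin n) :
    (ofIdempotent f hf).point x = f x :=
  ((ofIdempotent f hf).eq_point (hf x) (hf x)).symm

/-- Merge the blocks of the pointed elements `a` and `b`, and keep `a` as the pointed element of
the union. -/
noncomputable def absorb (π : PointedPartition n) (a b : Fin n) (ha : a ∈ π.points) (hab : a ≠ b) :
    PointedPartition n :=
  ofIdempotent (fun x => if π.point x = b then a else π.point x) fun x => by
    have := π.point_eq_self_iff.2 ha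
    grind [point_point]

theorem point_absorb (π : PointedPartition n) {a b : Fin n} (ha : a ∈ π.points) (hab : a ≠ b)
    (x : Fin n) : (π.absorb a b ha hab).point x = if π.point x = b then a else π.point x := by
  simp [absorb]

theorem points_absorb (π : PointedPartition n) {a b : Fin n} (ha : a ∈ π.points) (hab : a ≠ b) :
    (π.absorb a b ha hab).points = π.points \ {b} := by
  ext x
  have := π.point_eq_self_iff.2 ha
  have := π.point_eq_self_iff (x := x)
  rw [← point_eq_self_iff, point_absorb, Set.mem_sdiff, Set.mem_singleton_iff]
  grind

theorem ncard_points_absorb (π : PointedPartition n) {a b : Fin n} (ha : a ∈ π.points)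
    (hab : a ≠ b) (hb : b ∈ π.points) :
    (π.absorb a b ha hab).points.ncard + 1 = π.points.ncard := by
  rw [points_absorb, Set.ncard_sdiff_singleton_add_one hb]

theorem le_absorb (π : PointedPartition n) {a b : Fin n} (ha : a ∈ π.points)
    (hab : a ≠ b) : π ≤ π.absorb a b ha hab := by
  have h1 := π.point_eq_self_iff.2 ha
  rw [le_iff_point]
  intro x
  simp only [point_absorb, point_point]
  grind [point_point]

theorem absorb_le (π : PointedPartition n) {ν : PointedPartition n} {a b : Fin n}
    (ha : a ∈ π.points) (hab : a ≠ b) (h : π ≤ ν) (hν : ν.point b = ν.point a)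
    (hb : b ∉ ν.points) : π.absorb a b ha hab ≤ ν := by
  rw [← point_eq_self_iff] at hb
  rw [le_iff_point] at h ⊢
  intro x
  have h1 := (h x).1
  have h2 := (h x).2
  rw [point_absorb, point_absorb, h2]
  have := ν.point_point x
  grind

theorem eq_of_le_of_ncard {π ν : PointedPartition n} (h : π ≤ ν)
    (hc : π.points.ncard ≤ ν.points.ncard) : π = ν := by
  have hp : ν.points = π.points := Set.eq_of_subset_of_ncard_le h.2 hc (Set.toFinite _)
  refine ext_point fun x => ?_
  rw [← (le_iff_point.1 h x).1, eq_comm, point_eq_self_iff, hp]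
  exact π.point_mem x

theorem ncard_points_lt {π ν : PointedPartition n} (h : π < ν) :
    ν.points.ncard < π.points.ncard :=
  lt_of_not_ge fun hc => h.ne (eq_of_le_of_ncard h.le hc)

/-- A step up from `π` towards `ν`: absorb a point that `ν` drops into the point which `ν` keeps
in its place. -/
theorem exists_absorb_le {π ν : PointedPartition n} (h : π < ν) :
    ∃ (a b : Fin n) (ha : a ∈ π.points) (hab : a ≠ b), b ∈ π.points ∧
      π.absorb a b ha hab ≤ ν := by
  obtain ⟨b, hb, hb'⟩ := Set.exists_of_ssubset
    (h.le.2.ssubset_of_ne fun hp => (ncard_points_lt h).ne (congrArg Set.ncard hp))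
  refine ⟨ν.point b, b, h.le.2 (ν.point_mem b), fun hb₁ => hb' (ν.point_eq_self_iff.1 hb₁), hb,
    absorb_le _ _ _ h.le (by simp) hb'⟩

theorem covBy_iff {π ν : PointedPartition n} :
    π ⋖ ν ↔ π ≤ ν ∧ ν.points.ncard + 1 = π.points.ncard := by
  constructor
  · intro h
    obtain ⟨a, b, ha, hab, hb, hle⟩ := exists_absorb_le h.lt
    refine ⟨h.le, ?_⟩
    have hc := π.ncard_points_absorb ha hab hb
    rcases h.eq_or_eq (π.le_absorb ha hab) hle with h' | h'
    · rw [h'] at hc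
      omega
    · rwa [h'] at hc
  · rintro ⟨h, hc⟩
    refine ⟨h.lt_of_ne fun h' => ?_, fun σ h₁ h₂ => ?_⟩
    · rw [h'] at hc
      omega
    · have := ncard_points_lt h₁
      have := ncard_points_lt h₂
      omega

theorem exists_covBy_eq_absorb {π ν : PointedPartition n} (h : π ⋖ ν) :
    ∃ (a b : Fin n) (ha : a ∈ π.points) (hab : a ≠ b), b ∈ π.points ∧
      ν = π.absorb a b ha hab := by
  obtain ⟨a, b, ha, hab, hb, hle⟩ := exists_absorb_le h.lt
  refine ⟨a, b, ha, hab, hb, (eq_of_le_of_ncard hle ?_).symm⟩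
  have := π.ncard_points_absorb ha hab hb
  have := (covBy_iff.1 h).2
  omega

theorem ncard_points_le_card (π : PointedPartition n) : π.points.ncard ≤ n := by
  simpa using Set.ncard_le_card π.points

/-- The pointed partition with a single block, pointed at `e`. -/
def single (e : Fin n) : PointedPartition n :=
  ofIdempotent (fun _ => e) fun _ => rfl

theorem le_single {π : PointedPartition n} {e : Fin n} (he : e ∈ π.points) : π ≤ single e := by
  rw [le_iff_point]
  intro x
  simp [single, π.point_eq_self_iff.2 he]

theorem ncard_points_le_one_of_coe_covBy_top {π : PointedPartition n}
    (h : (π : ExtendedPointedPartition n) ⋖ ⊤) : π.points.ncard ≤ 1 := by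
  by_contra! hc
  obtain ⟨a, ha, b, hb, hab⟩ := (Set.one_lt_ncard (Set.toFinite _)).1 hc
  have hlt : π < π.absorb a b ha hab := by
    refine (π.le_absorb ha hab).lt_of_ne fun h' => ?_
    have := π.ncard_points_absorb ha hab hb
    rw [← h'] at this
    omega
  exact h.2 (WithTop.coe_lt_coe.2 hlt) (WithTop.coe_lt_top _)

theorem coe_covBy_top {π : PointedPartition n} (h : π.points.ncard ≤ 1) :
    (π : ExtendedPointedPartition n) ⋖ ⊤ := by
  refine ⟨WithTop.coe_lt_top _, fun c h₁ h₂ => ?_⟩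
  lift c to PointedPartition n using h₂.ne
  have h₃ := ncard_points_lt (WithTop.coe_lt_coe.1 h₁)
  have h₄ : c.points.ncard = 0 := by omega
  rw [Set.ncard_eq_zero (Set.toFinite _)] at h₄
  have h₅ : 0 < π.points.ncard := by omega
  obtain ⟨x, -⟩ := (Set.ncard_pos (Set.toFinite _)).1 h₅
  simpa [h₄] using c.point_mem x

end PointedPartition

/-- The rank function: a pointed partition of `[n]` with `k` blocks has rank `n - k`. The top element
gets the rank `n - 1 + 1`, which is `n` unless `n = 0`. -/
noncomputable instance (n : ℕ) : GradeOrder ℕ (ExtendedPointedPartition n) where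
  grade := WithTop.recTopCoe (n - 1 + 1) fun π => n - π.points.ncard
  grade_strictMono := by
    intro x y h
    lift x to PointedPartition n using (h.trans_le le_top).ne with π
    induction y using WithTop.recTopCoe with
    | top =>
      have h₁ : 0 < n → 0 < π.points.ncard := fun hn =>
        (Set.ncard_pos (Set.toFinite _)).2 ⟨_, π.point_mem ⟨0, hn⟩⟩
      simp only [WithTop.recTopCoe_coe, WithTop.recTopCoe_top]
      omega
    | coe ν =>
      have h₁ := PointedPartition.ncard_points_lt (WithTop.coe_lt_coe.1 h)
      have h₂ := π.ncard_points_le_card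
      simp only [WithTop.recTopCoe_coe]
      omega
  covBy_grade := by
    intro x y h
    rw [Nat.covBy_iff_add_one_eq]
    lift x to PointedPartition n using (h.lt.trans_le le_top).ne with π
    induction y using WithTop.recTopCoe with
    | top =>
      have h₁ : 0 < n → 0 < π.points.ncard := fun hn =>
        (Set.ncard_pos (Set.toFinite _)).2 ⟨_, π.point_mem ⟨0, hn⟩⟩
      have h₂ := PointedPartition.ncard_points_le_one_of_coe_covBy_top h
      simp only [WithTop.recTopCoe_coe, WithTop.recTopCoe_top]
      omega
    | coe ν =>
      have h₁ := (PointedPartition.covBy_iff.1 (WithTop.coe_covBy_coe.1 h)).2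
      have h₂ := π.ncard_points_le_card
      simp only [WithTop.recTopCoe_coe]
      omega

/-! ### Total semi-modularity -/

namespace FinPoset

/-- Total semi-modularity in terms of the coverings of the whole poset. -/
theorem isTotallySemimodular_iff {α : Type*} [PartialOrder α] [BoundedOrder α] :
    IsTotallySemimodular α ↔
      ∀ t u v y : α, t ⋖ u → t ⋖ v → u ≠ v → u ≤ y → v ≤ y → ∃ z ≤ y, u ⋖ z ∧ v ⋖ z := by
  have key (x y : α) (a b : Set.Icc x y) : (a : α) ⋖ b ↔ a ⋖ b :=
    Set.OrdConnected.apply_covBy_apply_iff (OrderEmbedding.subtype (· ∈ Set.Icc x y))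
      (by
        rw [OrderEmbedding.coe_subtype, Subtype.range_val]
        exact Set.ordConnected_Icc)
  constructor
  · intro h t u v y hu hv huv huy hvy
    obtain ⟨z, hz₁, hz₂⟩ := h t y (hu.le.trans huy) ⟨t, le_rfl, hu.le.trans huy⟩ ⟨u, hu.le, huy⟩
      ⟨v, hv.le, hvy⟩ ((key _ _ _ _).1 hu) ((key _ _ _ _).1 hv)
      (fun h => huv (congrArg Subtype.val h))
    exact ⟨z, z.2.2, (key _ _ _ _).2 hz₁, (key _ _ _ _).2 hz₂⟩
  · intro h x y hxy t u v hu hv huv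
    obtain ⟨z, hzy, hz₁, hz₂⟩ := h t u v y ((key _ _ _ _).2 hu) ((key _ _ _ _).2 hv)
      (fun h => huv (Subtype.ext h)) u.2.2 v.2.2
    exact ⟨⟨z, u.2.1.trans hz₁.le, hzy⟩, (key _ _ _ _).1 hz₁, (key _ _ _ _).1 hz₂⟩

end FinPoset

namespace PointedPartition

variable {n : ℕ}

/-- Two points of `π` that `ν` drops can be absorbed simultaneously into points that stay. -/
theorem exists_absorb_two {π ν : PointedPartition n} (h : π ≤ ν) {b d p q : Fin n}
    (hb : b ∈ π.points) (hd : d ∈ π.points) (hbd : b ≠ d) (hp : p ∈ π.points) (hq : q ∈ π.points)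
    (hpb : p ≠ b) (hpd : p ≠ d) (hqb : q ≠ b) (hqd : q ≠ d) (hb' : b ∉ ν.points)
    (hd' : d ∉ ν.points) (hbp : ν.point b = ν.point p) (hdq : ν.point d = ν.point q) :
    ∃ σ ≤ ν, σ.points.ncard + 2 = π.points.ncard ∧
      ∀ x, σ.point x = if π.point x = b then p else if π.point x = d then q else π.point x := by
  have hq₁ : q ∈ (π.absorb p b hp hpb).points := by
    rw [points_absorb]
    exact ⟨hq, hqb⟩
  have hd₁ : d ∈ (π.absorb p b hp hpb).points := by
    rw [points_absorb]
    exact ⟨hd, hbd.symm⟩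
  refine ⟨(π.absorb p b hp hpb).absorb q d hq₁ hqd,
    absorb_le _ _ _ (absorb_le _ _ _ h hbp hb') hdq hd', ?_, fun x => ?_⟩
  · have h₁ := ncard_points_absorb _ hq₁ hqd hd₁
    have h₂ := ncard_points_absorb _ hp hpb hb
    omega
  · rw [point_absorb, point_absorb]
    grind

/-- Semi-modularity of the poset of pointed partitions, below an element `ν`. If the two steps
absorb `b` into `a` and `d` into `c`, a common covering element drops two of `a, b, c, d`, and `ν`
decides which ones: a point stays only if `ν` keeps it or sends it into another block. -/
theorem exists_covBy_covBy_le {π u v ν : PointedPartition n} (hu : π ⋖ u) (hv : π ⋖ v)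
    (huv : u ≠ v) (huν : u ≤ ν) (hvν : v ≤ ν) : ∃ σ ≤ ν, u ⋖ σ ∧ v ⋖ σ := by
  have hπν : π ≤ ν := hu.le.trans huν
  have hcu := (covBy_iff.1 hu).2
  have hcv := (covBy_iff.1 hv).2
  obtain ⟨a, b, ha, hab, hb, rfl⟩ := exists_covBy_eq_absorb hu
  obtain ⟨c, d, hc, hcd, hd, rfl⟩ := exists_covBy_eq_absorb hv
  have ha' := π.point_eq_self_iff.2 ha
  have hb' := π.point_eq_self_iff.2 hb
  have hc' := π.point_eq_self_iff.2 hc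
  have hd' := π.point_eq_self_iff.2 hd
  have hbν : b ∉ ν.points := fun hb₁ => by
    have := huν.2 hb₁
    rw [points_absorb] at this
    exact this.2 rfl
  have hdν : d ∉ ν.points := fun hd₁ => by
    have := hvν.2 hd₁
    rw [points_absorb] at this
    exact this.2 rfl
  have hbaν : ν.point b = ν.point a := by
    have := (le_iff_point.1 huν b).1
    rw [point_absorb, if_pos hb'] at this
    exact this.symm
  have hdcν : ν.point d = ν.point c := by
    have := (le_iff_point.1 hvν d).1
    rw [point_absorb, if_pos hd'] at this
    exact this.symm
  -- A candidate that drops two points covers both as soon as it lies above both.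
  suffices H : ∃ σ ≤ ν, σ.points.ncard + 2 = π.points.ncard ∧
      (∀ x, σ.point (if π.point x = b then a else π.point x) = σ.point x) ∧
      (∀ x, σ.point (if π.point x = d then c else π.point x) = σ.point x) ∧
      ∀ x, π.point (σ.point x) = σ.point x ∧ σ.point x ≠ b ∧ σ.point x ≠ d by
    obtain ⟨σ, hσν, hσ, h₁, h₂, h₃⟩ := H
    refine ⟨σ, hσν, covBy_iff.2 ⟨le_iff_point.2 fun x => ?_, by omega⟩,
      covBy_iff.2 ⟨le_iff_point.2 fun x => ?_, by omega⟩⟩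
    · rw [point_absorb, point_absorb, h₁, (h₃ x).1]
      exact ⟨rfl, if_neg (h₃ x).2.1⟩
    · rw [point_absorb, point_absorb, h₂, (h₃ x).1]
      exact ⟨rfl, if_neg (h₃ x).2.2⟩
  have hπ := π.point_point
  have he : ν.point a ∈ π.points := hπν.2 (ν.point_mem a)
  have he' := π.point_eq_self_iff.2 he
  have heν := ν.point_point a
  have hea : ν.point a = a → a ∈ ν.points := ν.point_eq_self_iff.1
  have heb : ν.point a ≠ b := fun h => hbν (h ▸ ν.point_mem a)
  have hed : ν.point a ≠ d := fun h => hdν (h ▸ ν.point_mem a)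
  by_cases hbd : b = d
  · subst hbd
    have hac : a ≠ c := by
      rintro rfl
      exact huv rfl
    by_cases hcν : c ∈ ν.points
    · have hc₁ := ν.point_eq_self_iff.2 hcν
      have haν : a ∉ ν.points := fun h₁ => by
        have := ν.point_eq_self_iff.2 h₁
        grind
      obtain ⟨σ, h₁, h₂, h₃⟩ := exists_absorb_two hπν hb ha hab.symm hc hc hcd hac.symm hcd
        hac.symm hbν haν hdcν (by rw [← hbaν, hdcν])
      refine ⟨σ, h₁, h₂, ?_, ?_, ?_⟩ <;> intro x <;> simp only [h₃] <;> grind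
    · obtain ⟨σ, h₁, h₂, h₃⟩ := exists_absorb_two hπν hb hc hcd.symm ha ha hab hac hab
        hac hbν hcν hbaν (by rw [← hbaν, hdcν])
      refine ⟨σ, h₁, h₂, ?_, ?_, ?_⟩ <;> intro x <;> simp only [h₃] <;> grind
  · by_cases had : a = d
    · subst had
      by_cases hcb : c = b
      · subst hcb
        obtain ⟨σ, h₁, h₂, h₃⟩ := exists_absorb_two hπν hb hd hbd he he heb hed heb
          hed hbν hdν (by rw [hbaν, heν]) (by rw [heν])
        refine ⟨σ, h₁, h₂, ?_, ?_, ?_⟩ <;> intro x <;> simp only [h₃] <;> grind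
      · obtain ⟨σ, h₁, h₂, h₃⟩ := exists_absorb_two hπν hb hd hbd hc hc hcb hcd hcb
          hcd hbν hdν (by rw [hbaν, hdcν]) hdcν
        refine ⟨σ, h₁, h₂, ?_, ?_, ?_⟩ <;> intro x <;> simp only [h₃] <;> grind
    · by_cases hcb : c = b
      · subst hcb
        obtain ⟨σ, h₁, h₂, h₃⟩ := exists_absorb_two hπν hb hd hbd ha ha hab had hab
          had hbν hdν hbaν (by rw [hdcν, hbaν])
        refine ⟨σ, h₁, h₂, ?_, ?_, ?_⟩ <;> intro x <;> simp only [h₃] <;> grind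
      · obtain ⟨σ, h₁, h₂, h₃⟩ := exists_absorb_two hπν hb hd hbd ha hc hab had hcb
          hcd hbν hdν hbaν hdcν
        refine ⟨σ, h₁, h₂, ?_, ?_, ?_⟩ <;> intro x <;> simp only [h₃] <;> grind

end PointedPartition

theorem ExtendedPointedPartition.isTotallySemimodular (n : ℕ) :
    FinPoset.IsTotallySemimodular (ExtendedPointedPartition n) := by
  rw [FinPoset.isTotallySemimodular_iff]
  intro t u v y hu hv huv huy hvy
  lift t to PointedPartition n using (hu.lt.trans_le le_top).ne with π
  -- Two distinct elements covering the same element are incomparable.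
  have hne : ∀ {u v : ExtendedPointedPartition n}, ↑π ⋖ u → ↑π ⋖ v → u ≠ v → u ≠ ⊤ := by
    rintro u v hu hv huv rfl
    exact hu.2 hv.lt (lt_top_iff_ne_top.2 huv.symm)
  lift u to PointedPartition n using hne hu hv huv with u
  lift v to PointedPartition n using hne hv hu huv.symm with v
  rw [WithTop.coe_covBy_coe] at hu hv
  rw [ne_eq, WithTop.coe_inj] at huv
  have main (ν : PointedPartition n) (hy : (ν : ExtendedPointedPartition n) ≤ y) (huν : u ≤ ν)
      (hvν : v ≤ ν) : ∃ z ≤ y, ↑u ⋖ z ∧ ↑v ⋖ z := by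
    obtain ⟨σ, hσν, hσ⟩ := PointedPartition.exists_covBy_covBy_le hu hv huv huν hvν
    exact ⟨σ, (WithTop.coe_le_coe.2 hσν).trans hy, by simpa [WithTop.coe_covBy_coe] using hσ⟩
  induction y using WithTop.recTopCoe with
  | coe ν => exact main ν le_rfl (WithTop.coe_le_coe.1 huy) (WithTop.coe_le_coe.1 hvy)
  | top =>
    have hcu := (PointedPartition.covBy_iff.1 hu).2
    have hcv := (PointedPartition.covBy_iff.1 hv).2
    -- If `u` and `v` have a common point, they lie below a partition with one block; otherwise
    -- `π` has only two points and `⊤` covers both `u` and `v`.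
    by_cases he : ∃ e, e ∈ u.points ∧ e ∈ v.points
    · obtain ⟨e, heu, hev⟩ := he
      exact main (.single e) le_top (PointedPartition.le_single heu) (PointedPartition.le_single hev)
    · have hdis : Disjoint u.points v.points :=
        Set.disjoint_left.2 fun e h₁ h₂ => he ⟨e, h₁, h₂⟩
      have h₁ := Set.ncard_le_ncard (Set.union_subset hu.le.2 hv.le.2) (Set.toFinite _)
      rw [Set.ncard_union_eq hdis (Set.toFinite _) (Set.toFinite _)] at h₁
      exact ⟨⊤, le_rfl, PointedPartition.coe_covBy_top (by omega),
        PointedPartition.coe_covBy_top (by omega)⟩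

/-! ### Totally semi-modular posets are CL-shellable -/

namespace FinPoset

section Pure

variable {α : Type*} [PartialOrder α]

theorem isSaturatedChain_cons_cons {x y a b : α} {l : List α} :
    IsSaturatedChain x y (a :: b :: l) ↔ a = x ∧ a ⋖ b ∧ IsSaturatedChain b y (b :: l) := by
  simp only [IsSaturatedChain, List.isChain_cons_cons, List.head?_cons, Option.some.injEq,
    List.getLast?_cons_cons, true_and]
  tauto

theorem isSaturatedChain_singleton {x y a : α} : IsSaturatedChain x y [a] ↔ a = x ∧ a = y := by
  simp [IsSaturatedChain]

theorem not_isSaturatedChain_nil {x y : α} : ¬ IsSaturatedChain x y [] := by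
  simp [IsSaturatedChain]

theorem IsSaturatedChain.exists_eq_cons {x y : α} {c : List α} (h : IsSaturatedChain x y c) :
    ∃ l, c = x :: l := by
  cases c with
  | nil => exact absurd h not_isSaturatedChain_nil
  | cons a l =>
    have := h.2.1
    simp only [List.head?_cons, Option.some.injEq] at this
    exact ⟨l, this ▸ rfl⟩

theorem IsSaturatedChain.le {x y : α} {l : List α} (h : IsSaturatedChain x y (x :: l)) :
    x ≤ y := by
  induction l generalizing x with
  | nil => exact (isSaturatedChain_singleton.1 h).2.le
  | cons b l ih =>
    rw [isSaturatedChain_cons_cons] at h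
    exact h.2.1.le.trans (ih h.2.2)

theorem IsSaturatedChain.grade_add_length [GradeOrder ℕ α] {x y : α} {l : List α}
    (h : IsSaturatedChain x y (x :: l)) : grade ℕ x + l.length = grade ℕ y := by
  induction l generalizing x with
  | nil => rw [(isSaturatedChain_singleton.1 h).2]; rfl
  | cons b l ih =>
    rw [isSaturatedChain_cons_cons] at h
    have h₁ := ih h.2.2
    have h₂ := Nat.covBy_iff_add_one_eq.1 (h.2.1.grade ℕ)
    simp only [List.length_cons]
    omega

theorem isPure_of_gradeOrder [GradeOrder ℕ α] : IsPure α := by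
  intro x y c c' h h'
  obtain ⟨l, rfl⟩ := h.exists_eq_cons
  obtain ⟨l', rfl⟩ := h'.exists_eq_cons
  have := h.grade_add_length
  have := h'.grade_add_length
  simp only [List.length_cons]
  omega

end Pure

section Labeling

variable {α : Type*} [PartialOrder α] [Finite α]

/-- An arbitrary injective numbering of a finite type, by natural numbers less than its
cardinality. -/
noncomputable def numbering {α : Type*} [Finite α] (a : α) : ℕ := Finite.equivFin α a

theorem numbering_lt {α : Type*} [Finite α] (a : α) : numbering a < Nat.card α :=
  (Finite.equivFin α a).2

theorem numbering_injective {α : Type*} [Finite α] : Function.Injective (numbering : α → ℕ) :=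
  Fin.val_injective.comp (Finite.equivFin α).injective

open Classical in
/-- The label of the edge from the head of `r` to `z`, where `r` is a saturated chain in descending
order. If `x` precedes the head `a` of `r`, the atoms over `a` that lie above an atom over `x`
with a smaller label than `a` are called early. Early atoms get labels smaller than that of the edge
`x ⋖ a`, and all others get larger labels. For a root with a single element any injective labels
will do. -/
noncomputable def chainLabel : List α → α → ℤ
  | a :: x :: r, z =>
    if ∃ b, x ⋖ b ∧ chainLabel (x :: r) b < chainLabel (x :: r) a ∧ b ≤ z then
      chainLabel (x :: r) a - Nat.card α + numbering z
    else chainLabel (x :: r) a + 1 + numbering z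
  | _, z => numbering z

theorem chainLabel_lt_of_early {a x z b : α} {r : List α} (hb : x ⋖ b)
    (h : chainLabel (x :: r) b < chainLabel (x :: r) a) (hz : b ≤ z) :
    chainLabel (a :: x :: r) z < chainLabel (x :: r) a := by
  rw [chainLabel, if_pos ⟨b, hb, h, hz⟩]
  have := numbering_lt z
  omega

theorem lt_chainLabel_of_not_early {a x z : α} {r : List α}
    (h : ∀ b, x ⋖ b → chainLabel (x :: r) b < chainLabel (x :: r) a → ¬ b ≤ z) :
    chainLabel (x :: r) a < chainLabel (a :: x :: r) z := by
  rw [chainLabel, if_neg (by simpa using h)]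
  omega

theorem chainLabel_injective (r : List α) : Function.Injective (chainLabel r) := by
  intro z w h
  have hz := numbering_lt z
  have hw := numbering_lt w
  match r with
  | [] => exact numbering_injective (by simpa [chainLabel] using h)
  | [a] => exact numbering_injective (by simpa [chainLabel] using h)
  | a :: x :: r =>
    rw [chainLabel, chainLabel] at h
    apply numbering_injective
    split_ifs at h <;> omega

/-- The labels of the edges of the chain `x :: l`, where `r` is a chain in descending order with
head `x`. -/
noncomputable def chainLabels : List α → List α → List ℤ
  | _, [] => []
  | r, z :: l => chainLabel r z :: chainLabels (z :: r) l

theorem exists_first_atom (r : List α) {x y : α} (h : x < y) :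
    ∃ a, x ⋖ a ∧ a ≤ y ∧ ∀ b, x ⋖ b → b ≤ y → chainLabel r a ≤ chainLabel r b := by
  obtain ⟨a₀, h₁, h₂⟩ := exists_covBy_le_of_lt h
  obtain ⟨a, ha, hmin⟩ := Set.exists_min_image {a | x ⋖ a ∧ a ≤ y} (chainLabel r) (Set.toFinite _)
    ⟨a₀, h₁, h₂⟩
  exact ⟨a, ha.1, ha.2, fun b hb hby => hmin b ⟨hb, hby⟩⟩

variable (α) in
/-- The chain-edge labeling given by `chainLabel`. The edge `i` of `m` ends in `m[i + 1]`; beyond the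
end of `m` the label is `0`. -/
noncomputable def chainEdgeLabel (m : List α) (i : ℕ) : ℤ :=
  (m[i + 1]?).elim 0 (chainLabel (m.take (i + 1)).reverse)

theorem map_chainEdgeLabel (r l t : List α) (hr : r ≠ []) :
    (List.range' (r.length - 1) l.length).map (chainEdgeLabel α (r ++ l ++ t)) =
      chainLabels r.reverse l := by
  induction l generalizing r with
  | nil => simp [chainLabels]
  | cons z l ih =>
    have hlen := List.length_pos_iff.2 hr
    have h := ih (r ++ [z]) (by simp)
    rw [List.length_cons, List.range'_succ, List.map_cons, chainLabels]
    congr 1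
    · have h₁ : r.length - 1 + 1 = r.length := by omega
      simp [chainEdgeLabel, h₁]
    · have h₁ : r.length - 1 + 1 = (r ++ [z]).length - 1 := by simp; omega
      rw [h₁]
      simpa using h

variable [BoundedOrder α]

/-- An increasing chain starts with the first atom. If it started with a later atom `b`, then by
semi-modularity some atom over `b` would be early, hence so would the first atom over `b`, with
which the rest of the chain starts; but the label of an early atom is a descent. -/
theorem chainLabel_le_of_isChain_chainLabels (hα : IsTotallySemimodular α) {x b y : α}
    {r l : List α} (hc : IsSaturatedChain x y (x :: b :: l))
    (hinc : (chainLabels (x :: r) (b :: l)).IsChain (· ≤ ·)) {a : α} (ha : x ⋖ a) (hay : a ≤ y) :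
    chainLabel (x :: r) b ≤ chainLabel (x :: r) a := by
  rw [isTotallySemimodular_iff] at hα
  induction l generalizing x b r a with
  | nil =>
    rw [isSaturatedChain_cons_cons, isSaturatedChain_singleton] at hc
    obtain ⟨-, hxb, -, rfl⟩ := hc
    rcases hxb.eq_or_eq ha.le hay with h | h
    · exact absurd h ha.lt.ne'
    · rw [h]
  | cons c l ih =>
    rw [isSaturatedChain_cons_cons] at hc
    obtain ⟨-, hxb, hc⟩ := hc
    by_contra! hlt
    have hab : b ≠ a := by
      rintro rfl
      exact hlt.false
    obtain ⟨z, hzy, hbz, haz⟩ := hα x b a y hxb ha hab hc.le hay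
    have h₁ := chainLabel_lt_of_early ha hlt haz.le
    rw [chainLabels, chainLabels, List.isChain_cons_cons] at hinc
    have h₂ := ih hc (r := x :: r) (by rw [chainLabels]; exact hinc.2) hbz hzy
    exact absurd hinc.1 (not_le.2 (h₂.trans_lt h₁))

theorem exists_increasing_chain (hα : IsTotallySemimodular α) {x y : α} (r : List α)
    (hxy : x ≤ y) :
    ∃ l, IsSaturatedChain x y (x :: l) ∧ (chainLabels (x :: r) l).IsChain (· ≤ ·) ∧
      ∀ l', IsSaturatedChain x y (x :: l') → l' ≠ l →
        ¬ (chainLabels (x :: r) l').IsChain (· ≤ ·) ∧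
          List.Lex (· < ·) (chainLabels (x :: r) l) (chainLabels (x :: r) l') := by
  induction x using (wellFounded_gt (α := α)).induction generalizing r with
  | _ x ih =>
  rcases hxy.eq_or_lt with rfl | hlt
  · refine ⟨[], by simp [IsSaturatedChain], by simp [chainLabels], fun l' hl' hne => ?_⟩
    cases l' with
    | nil => exact absurd rfl hne
    | cons b l =>
      rw [isSaturatedChain_cons_cons] at hl'
      exact absurd hl'.2.2.le (not_le_of_gt hl'.2.1.lt)
  · obtain ⟨a, hxa, hay, hmin⟩ := exists_first_atom (x :: r) hlt
    obtain ⟨l, hl, hinc, huniq⟩ := ih a hxa.lt (x :: r) hay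
    refine ⟨a :: l, isSaturatedChain_cons_cons.2 ⟨rfl, hxa, hl⟩, ?_, fun l' hl' hne => ?_⟩
    · rw [chainLabels]
      cases l with
      | nil => simp [chainLabels]
      | cons c l =>
        rw [chainLabels, List.isChain_cons_cons]
        refine ⟨(lt_chainLabel_of_not_early fun b hb hlt' hbc => ?_).le, by
          rwa [chainLabels] at hinc⟩
        rw [isSaturatedChain_cons_cons] at hl
        exact absurd (hmin b hb (hbc.trans hl.2.2.le)) (not_le.2 hlt')
    · cases l' with
      | nil => exact absurd (isSaturatedChain_singleton.1 hl').2 hlt.ne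
      | cons b l' =>
        have hl'' := isSaturatedChain_cons_cons.1 hl'
        by_cases hab : b = a
        · subst hab
          obtain ⟨h₁, h₂⟩ := huniq l' hl''.2.2 fun h => hne (by rw [h])
          rw [chainLabels, chainLabels]
          exact ⟨fun h => h₁ (List.isChain_of_isChain_cons h), List.Lex.cons h₂⟩
        · have hlt' : chainLabel (x :: r) a < chainLabel (x :: r) b :=
            (hmin b hl''.2.1 hl''.2.2.le).lt_of_ne fun h => hab (chainLabel_injective _ h.symm)
          refine ⟨fun h => ?_, by rw [chainLabels, chainLabels]; exact List.Lex.rel hlt'⟩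
          exact absurd (chainLabel_le_of_isChain_chainLabels hα hl' h hxa hay) (not_le.2 hlt')

theorem isCLLabeling_chainEdgeLabel (hα : IsTotallySemimodular α) :
    IsCLLabeling (chainEdgeLabel α) := by
  refine ⟨fun m m' _ _ d h i hi => ?_, fun x y r t hxy hr _ => ?_⟩
  · have h₁ : m[i + 1]? = m'[i + 1]? := by
      rw [← List.getElem?_take_of_lt (by omega : i + 1 < d + 1), h,
        List.getElem?_take_of_lt (by omega)]
    have h₂ : m.take (i + 1) = m'.take (i + 1) := by
      have := congrArg (List.take (i + 1)) h
      rwa [List.take_take, List.take_take, min_eq_left (by omega)] at this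
    rw [chainEdgeLabel, chainEdgeLabel, h₁, h₂]
  · have hr' : r ≠ [] := by
      rintro rfl
      exact not_isSaturatedChain_nil hr
    obtain ⟨r', hrev⟩ : ∃ r', r.reverse = x :: r' := by
      have h₁ : r.reverse.head? = some x := by rw [List.head?_reverse, hr.2.2]
      obtain ⟨r', h⟩ := List.head?_eq_some_iff.1 h₁
      exact ⟨r', h⟩
    have hlab (l : List α) : labelSeq (chainEdgeLabel α) r (x :: l) t =
        chainLabels (x :: r') l := by
      simpa [labelSeq, ← hrev] using map_chainEdgeLabel r l t.tail hr'
    obtain ⟨l, hl, hinc, huniq⟩ := exists_increasing_chain hα r' hxy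
    refine ⟨x :: l, hl, by rwa [hlab], fun c' hc' hne => ?_⟩
    obtain ⟨l', rfl⟩ := hc'.exists_eq_cons
    rw [hlab, hlab]
    exact huniq l' hc' fun h => hne (by rw [h])

theorem IsTotallySemimodular.isCLShellable [GradeOrder ℕ α] (hα : IsTotallySemimodular α) :
    IsCLShellable α :=
  ⟨isPure_of_gradeOrder, ℤ, inferInstance, chainEdgeLabel α, isCLLabeling_chainEdgeLabel hα⟩

end Labeling

end FinPoset

/-! ### Exactness of chain complexes of subsets of a poset -/

namespace FinPoset

section ChainsIn

variable (K : Type*) [CommRing K] {α : Type*} [PartialOrder α]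

variable (α) in
/-- The boundary map out of degree `k` of the augmented chain complex; it is zero for `k = 0`,
where `k - 1` is again `0`, so that its kernel is the module of cycles in every degree. -/
noncomputable def boundaryFrom : (k : ℕ) → ((Fin k ↪o α) →₀ K) →ₗ[K] ((Fin (k - 1) ↪o α) →₀ K)
  | 0 => 0
  | k + 1 => boundary K α k

theorem boundaryFrom_boundary (k : ℕ) (y : (Fin (k + 1) ↪o α) →₀ K) :
    boundaryFrom K α k (boundary K α k y) = 0 := by
  cases k with
  | zero => rfl
  | succ k => exact LinearMap.congr_fun (boundary_comp_boundary K α k) y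

/-- The chains of the order complex of `α` with `k` elements, all of them in `S`. -/
noncomputable def chainsIn (S : Set α) (k : ℕ) : Submodule K ((Fin k ↪o α) →₀ K) :=
  Finsupp.supported K K {c | ∀ i, c i ∈ S}

theorem chainsIn_mono {S T : Set α} (h : S ⊆ T) (k : ℕ) : chainsIn K S k ≤ chainsIn K T k :=
  Finsupp.supported_mono fun _ hc i => h (hc i)

theorem mem_chainsIn_inter {S T : Set α} {k : ℕ} {x : (Fin k ↪o α) →₀ K}
    (hS : x ∈ chainsIn K S k) (hT : x ∈ chainsIn K T k) : x ∈ chainsIn K (S ∩ T) k := by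
  rw [chainsIn, Finsupp.mem_supported] at *
  exact fun c hc i => ⟨hS hc i, hT hc i⟩

variable {K} in
@[elab_as_elim]
theorem chainsIn_induction {S : Set α} {k : ℕ} {p : ((Fin k ↪o α) →₀ K) → Prop}
    {x : (Fin k ↪o α) →₀ K} (hx : x ∈ chainsIn K S k) (zero : p 0)
    (add : ∀ x y, p x → p y → p (x + y))
    (single : ∀ c : Fin k ↪o α, (∀ i, c i ∈ S) → ∀ r, p (Finsupp.single c r)) : p x := by
  rw [← Finsupp.sum_single x]
  exact Finset.sum_induction _ p add zero fun c hc =>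
    single c ((Finsupp.mem_supported K x).1 hx hc) _

theorem boundary_mem_chainsIn {S : Set α} {k : ℕ} {x : (Fin (k + 1) ↪o α) →₀ K}
    (hx : x ∈ chainsIn K S (k + 1)) : boundary K α k x ∈ chainsIn K S k := by
  refine chainsIn_induction hx (by simp) (fun x y h₁ h₂ => ?_) fun c hc r => ?_
  · rw [map_add]
    exact add_mem h₁ h₂
  · rw [boundary_single]
    exact sum_mem fun i _ => Finsupp.single_mem_supported K _ fun j => hc _

/-- The augmented chain complex of the order complex of `S` is exact in degree `k`. -/
def ExactIn (S : Set α) (k : ℕ) : Prop :=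
  ∀ x ∈ chainsIn K S k, boundaryFrom K α k x = 0 → ∃ y ∈ chainsIn K S (k + 1), boundary K α k y = x

variable {K}

/-- The part of the Mayer–Vietoris sequence that is needed: if every chain in `S` is a chain in `U`
or in `V`, the order complex of `S` is the union of those of `U` and `V`. -/
theorem ExactIn.union {S U V : Set α} {k : ℕ} (hUS : U ⊆ S) (hVS : V ⊆ S)
    (hS : ∀ (k : ℕ) (c : Fin k ↪o α), (∀ i, c i ∈ S) → (∀ i, c i ∈ U) ∨ ∀ i, c i ∈ V)
    (hU : ExactIn K U k) (hV : ExactIn K V k) (hW : ∀ j, k = j + 1 → ExactIn K (U ∩ V) j) :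
    ExactIn K S k := by
  intro x hx hx₀
  have hsup : chainsIn K S k ≤ chainsIn K U k ⊔ chainsIn K V k := by
    rw [chainsIn, chainsIn, chainsIn, ← Finsupp.supported_union]
    exact Finsupp.supported_mono (hS k)
  obtain ⟨u, hu, v, hv, rfl⟩ := Submodule.mem_sup.1 (hsup hx)
  -- It suffices to correct `u` and `v` by a chain `w` of the intersection to make them cycles.
  suffices H : ∃ w ∈ chainsIn K (U ∩ V) k, boundaryFrom K α k w = boundaryFrom K α k u by
    obtain ⟨w, hw, hwu⟩ := H
    obtain ⟨u', hu', hu''⟩ := hU (u - w)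
      (sub_mem hu (chainsIn_mono K Set.inter_subset_left _ hw)) (by rw [map_sub, hwu, sub_self])
    obtain ⟨v', hv', hv''⟩ := hV (v + w)
      (add_mem hv (chainsIn_mono K Set.inter_subset_right _ hw))
      (by rw [map_add, hwu, ← map_add, add_comm, hx₀])
    refine ⟨u' + v', add_mem (chainsIn_mono K hUS _ hu') (chainsIn_mono K hVS _ hv'), ?_⟩
    rw [map_add, hu'', hv'']
    abel
  cases k with
  | zero => exact ⟨0, zero_mem _, rfl⟩
  | succ j =>
    have h : boundary K α j u = -boundary K α j v := by
      rw [eq_neg_iff_add_eq_zero, ← map_add]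
      exact hx₀
    refine hW j rfl (boundary K α j u) (mem_chainsIn_inter K (boundary_mem_chainsIn K hu) ?_)
      (boundaryFrom_boundary K j u)
    rw [h]
    exact neg_mem (boundary_mem_chainsIn K hv)

/-- The chain obtained by putting `a` below all elements of `c`. -/
def consChain {k : ℕ} (a : α) (c : Fin k ↪o α) (h : ∀ i, a < c i) : Fin (k + 1) ↪o α :=
  OrderEmbedding.ofStrictMono (Fin.cons a c) (by
    intro i j hij
    induction i using Fin.cases with
    | zero =>
      induction j using Fin.cases with
      | zero => exact absurd hij (lt_irrefl _)
      | succ j => simpa using h j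
    | succ i =>
      induction j using Fin.cases with
      | zero => exact absurd hij (Fin.not_lt_zero _)
      | succ j => simpa using hij)

@[simp]
theorem consChain_zero {k : ℕ} (a : α) (c : Fin k ↪o α) (h : ∀ i, a < c i) :
    consChain a c h 0 = a := rfl

@[simp]
theorem consChain_succ {k : ℕ} (a : α) (c : Fin k ↪o α) (h : ∀ i, a < c i) (i : Fin k) :
    consChain a c h i.succ = c i := rfl

open Classical in
variable (K) in
/-- The cone operator: put `a` below a chain if possible, and send the other chains to `0`. -/
noncomputable def cone (a : α) (k : ℕ) : ((Fin k ↪o α) →₀ K) →ₗ[K] ((Fin (k + 1) ↪o α) →₀ K) :=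
  Finsupp.lift _ K _ fun c =>
    if h : ∀ i, a < c i then Finsupp.single (consChain a c h) 1 else 0

theorem cone_single_of_lt {k : ℕ} {a : α} {c : Fin k ↪o α} (h : ∀ i, a < c i) (r : K) :
    cone K a k (Finsupp.single c r) = Finsupp.single (consChain a c h) r := by
  simp [cone, h]

theorem cone_single_of_not_lt {k : ℕ} {a : α} {c : Fin k ↪o α} (h : ¬ ∀ i, a < c i) (r : K) :
    cone K a k (Finsupp.single c r) = 0 := by
  simp [cone, h]

theorem cone_mem_chainsIn {S : Set α} {a : α} (ha : a ∈ S) {k : ℕ} {x : (Fin k ↪o α) →₀ K}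
    (hx : x ∈ chainsIn K S k) : cone K a k x ∈ chainsIn K S (k + 1) := by
  refine chainsIn_induction hx (by simp) (fun x y h₁ h₂ => ?_) fun c hc r => ?_
  · rw [map_add]
    exact add_mem h₁ h₂
  · by_cases h : ∀ i, a < c i
    · rw [cone_single_of_lt h]
      refine Finsupp.single_mem_supported K _ fun j => ?_
      induction j using Fin.cases with
      | zero => exact ha
      | succ j => exact hc j
    · rw [cone_single_of_not_lt h]
      exact zero_mem _

theorem boundary_cone_single_zero (a : α) (c : Fin 0 ↪o α) (r : K) :
    boundary K α 0 (cone K a 0 (Finsupp.single c r)) = Finsupp.single c r := by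
  rw [cone_single_of_lt fun i => i.elim0, boundary_single]
  have : (Fin.succAboveOrderEmb 0).trans (consChain a c fun i => i.elim0) = c := by
    ext i
    exact i.elim0
  simp [this]

/-- The cone operator is a contracting homotopy. -/
theorem boundary_cone_single_succ {k : ℕ} {a : α} {c : Fin (k + 1) ↪o α} (h : ∀ i, a ≤ c i)
    (r : K) :
    boundary K α (k + 1) (cone K a (k + 1) (Finsupp.single c r)) +
      cone K a k (boundary K α k (Finsupp.single c r)) = Finsupp.single c r := by
  rw [boundary_single K α k, map_sum]
  by_cases h₀ : a < c 0
  · have hlt : ∀ i, a < c i := fun i => h₀.trans_le (c.monotone (Fin.zero_le i))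
    rw [cone_single_of_lt hlt, boundary_single, Fin.sum_univ_succ, add_assoc,
      ← Finset.sum_add_distrib, Finset.sum_eq_zero, add_zero]
    · have : (Fin.succAboveOrderEmb 0).trans (consChain a c hlt) = c := by
        ext i
        simp
      simp [this]
    · intro i _
      have hlt' : ∀ j, a < ((Fin.succAboveOrderEmb i).trans c) j := fun j => hlt _
      have : (Fin.succAboveOrderEmb i.succ).trans (consChain a c hlt) =
          consChain a ((Fin.succAboveOrderEmb i).trans c) hlt' := by
        ext j
        induction j using Fin.cases with
        | zero => simp
        | succ j => simp
      rw [cone_single_of_lt hlt', this, ← Finsupp.single_add]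
      simp [pow_succ]
  · have hc₀ : c 0 = a := ((h 0).eq_of_not_lt h₀).symm
    have hlt : ∀ i : Fin k, a < c i.succ := fun i =>
      hc₀ ▸ c.strictMono (Fin.succ_pos i)
    rw [cone_single_of_not_lt fun h' => h₀ (h' 0), map_zero, zero_add, Fin.sum_univ_succ,
      Finset.sum_eq_zero, add_zero]
    · have hlt' : ∀ j, a < ((Fin.succAboveOrderEmb 0).trans c) j := fun j => by simpa using hlt j
      rw [cone_single_of_lt hlt']
      have : consChain a ((Fin.succAboveOrderEmb 0).trans c) hlt' = c := by
        ext j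
        induction j using Fin.cases with
        | zero => simp [hc₀]
        | succ j => simp
      simp [this]
    · intro i _
      refine cone_single_of_not_lt (fun h' => ?_) _
      obtain ⟨k, rfl⟩ : ∃ m, k = m + 1 := ⟨k - 1, by have := i.2; omega⟩
      have := h' 0
      simp [hc₀] at this

theorem exactIn_of_isLeast {S : Set α} {a : α} (ha : IsLeast S a) (k : ℕ) : ExactIn K S k := by
  intro x hx hx₀
  refine ⟨cone K a k x, cone_mem_chainsIn ha.1 hx, ?_⟩
  cases k with
  | zero =>
    clear hx hx₀
    induction x using Finsupp.induction_linear with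
    | zero => simp
    | add x y hx hy => rw [map_add, map_add, hx, hy]
    | single c r => exact boundary_cone_single_zero a c r
  | succ k =>
    replace hx₀ : boundary K α k x = 0 := hx₀
    suffices H : boundary K α (k + 1) (cone K a (k + 1) x) + cone K a k (boundary K α k x) = x by
      rwa [hx₀, map_zero, add_zero] at H
    clear hx₀
    refine chainsIn_induction hx (by simp) (fun x y hx hy => ?_) fun c hc r =>
      boundary_cone_single_succ (fun i => ha.2 (hc i)) r
    simp only [map_add]
    rw [add_add_add_comm, hx, hy]

theorem exactIn_empty {k : ℕ} (hk : k ≠ 0) : ExactIn K (∅ : Set α) k := by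
  obtain ⟨j, rfl⟩ := Nat.exists_eq_succ_of_ne_zero hk
  intro x hx _
  refine ⟨0, zero_mem _, ?_⟩
  rw [map_zero, eq_comm, ← Finsupp.support_eq_empty, Finset.eq_empty_iff_forall_notMem]
  exact fun c hc => (Finsupp.mem_supported K x).1 hx hc 0

end ChainsIn

/-! ### Totally semi-modular posets are Cohen–Macaulay -/

section CohenMacaulay

variable {K : Type*} [CommRing K] {α : Type*} [PartialOrder α] [BoundedOrder α] [Finite α]
  [GradeOrder ℕ α]

/-- The part of an open interval `(x, y)` above a nonempty set of atoms of `[x, y]` has reduced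
homology only in the dimension of `(x, y)`. Adding one more atom `a` glues in the cone `[a, y)`
along its intersection with the rest, and by semi-modularity this intersection is the part of
`(a, y)` above a nonempty set of atoms of `[a, y]`. -/
theorem IsTotallySemimodular.exactIn_above_atoms (hα : IsTotallySemimodular α) {d k : ℕ}
    {x y : α} (hd : grade ℕ y = grade ℕ x + d + 1) (hk : k ≠ d) {A : Finset α}
    (hA : A.Nonempty) (hxA : ∀ a ∈ A, x ⋖ a) (hAy : ∀ a ∈ A, a ≤ y) :
    ExactIn K {z | z < y ∧ ∃ a ∈ A, a ≤ z} k := by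
  induction d generalizing k x A with
  | zero =>
    have h : {z | z < y ∧ ∃ a ∈ A, a ≤ z} = ∅ := by
      refine Set.eq_empty_of_forall_notMem fun z ⟨hzy, a, ha, haz⟩ => ?_
      have h₁ := grade_strictMono (𝕆 := ℕ) (haz.trans_lt hzy)
      have h₂ := Nat.covBy_iff_add_one_eq.1 ((hxA a ha).grade ℕ)
      omega
    rw [h]
    exact exactIn_empty hk
  | succ d ih =>
    have hlt : ∀ a, x ⋖ a → a ≤ y → a < y := fun a hxa hay => by
      refine hay.lt_of_ne fun h => ?_
      have := Nat.covBy_iff_add_one_eq.1 (hxa.grade ℕ)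
      rw [h] at this
      omega
    have hcone : ∀ a, a < y → IsLeast {z | z < y ∧ a ≤ z} a := fun a ha =>
      ⟨⟨ha, le_rfl⟩, fun z hz => hz.2⟩
    induction hA using Finset.Nonempty.cons_induction with
    | singleton a =>
      simpa using exactIn_of_isLeast
        (hcone a (hlt a (hxA a (by simp)) (hAy a (by simp)))) k
    | cons a s has hs ihs =>
      simp only [Finset.mem_cons, forall_eq_or_imp] at hxA hAy
      have hay := hlt a hxA.1 hAy.1
      have hwa : ∀ b ∈ s, ∀ y' ≤ y, a ≤ y' → b ≤ y' → ∃ w ≤ y', b ≤ w ∧ a ⋖ w := by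
        intro b hb y' _ ha' hb'
        obtain ⟨w, hw, h₁, h₂⟩ := isTotallySemimodular_iff.1 hα x a b y' hxA.1 (hxA.2 b hb)
          (by rintro rfl; exact has hb) ha' hb'
        exact ⟨w, hw, h₂.le, h₁⟩
      refine ExactIn.union (U := {z | z < y ∧ ∃ a ∈ s, a ≤ z}) (V := {z | z < y ∧ a ≤ z})
        (fun z ⟨hz, b, hb, hbz⟩ => ⟨hz, b, Finset.mem_cons_of_mem hb, hbz⟩)
        (fun z ⟨hz, haz⟩ => ⟨hz, a, Finset.mem_cons_self _ _, haz⟩) (fun m c hc => ?_)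
        (ihs hxA.2 hAy.2) (exactIn_of_isLeast (hcone a hay) k) (fun j hj => ?_)
      · -- A chain lies in the part that contains its least element.
        cases m with
        | zero => exact Or.inl fun i => i.elim0
        | succ m =>
          obtain ⟨-, b, hb, hbc⟩ := hc 0
          have hle : ∀ i, b ≤ c i := fun i => hbc.trans (c.monotone (Fin.zero_le i))
          rcases Finset.mem_cons.1 hb with rfl | hb
          · exact Or.inr fun i => ⟨(hc i).1, hle i⟩
          · exact Or.inl fun i => ⟨(hc i).1, b, hb, hle i⟩
      · let B : Set α := {w | a ⋖ w ∧ w ≤ y ∧ ∃ b ∈ s, b ≤ w}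
        have hB : ∀ w, w ∈ (Set.toFinite B).toFinset ↔ a ⋖ w ∧ w ≤ y ∧ ∃ b ∈ s, b ≤ w :=
          fun w => Set.Finite.mem_toFinset _
        have hW : {z | z < y ∧ ∃ a ∈ s, a ≤ z} ∩ {z | z < y ∧ a ≤ z} =
            {z | z < y ∧ ∃ w ∈ (Set.toFinite B).toFinset, w ≤ z} := by
          ext z
          constructor
          · rintro ⟨⟨hz, b, hb, hbz⟩, -, haz⟩
            obtain ⟨w, hwz, hbw, haw⟩ := hwa b hb z hz.le haz hbz
            exact ⟨hz, w, (hB w).2 ⟨haw, hwz.trans hz.le, b, hb, hbw⟩, hwz⟩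
          · rintro ⟨hz, w, hw, hwz⟩
            obtain ⟨haw, -, b, hb, hbw⟩ := (hB w).1 hw
            exact ⟨⟨hz, b, hb, hbw.trans hwz⟩, hz, haw.le.trans hwz⟩
        rw [hW]
        have hga := Nat.covBy_iff_add_one_eq.1 (hxA.1.grade ℕ)
        refine ih (x := a) (by omega) (by omega) ?_ (fun w hw => ((hB w).1 hw).1)
          (fun w hw => ((hB w).1 hw).2.1)
        obtain ⟨b, hb⟩ := hs
        obtain ⟨w, hwy, hbw, haw⟩ := hwa b hb y le_rfl hay.le (hAy.2 b hb)
        exact ⟨w, (hB w).2 ⟨haw, hwy, b, hb, hbw⟩⟩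

theorem IsTotallySemimodular.exactIn_Ioo (hα : IsTotallySemimodular α) {d k : ℕ}
    {x y : α} (hd : grade ℕ y = grade ℕ x + d + 1) (hxy : x < y) (hk : k ≠ d) :
    ExactIn K (Set.Ioo x y) k := by
  let A : Set α := {a | x ⋖ a ∧ a ≤ y}
  have hA : ∀ a, a ∈ (Set.toFinite A).toFinset ↔ x ⋖ a ∧ a ≤ y :=
    fun a => Set.Finite.mem_toFinset _
  have h : Set.Ioo x y = {z | z < y ∧ ∃ a ∈ (Set.toFinite A).toFinset, a ≤ z} := by
    ext z
    constructor
    · rintro ⟨hx, hy⟩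
      obtain ⟨a, hxa, haz⟩ := exists_covBy_le_of_lt hx
      exact ⟨hy, a, (hA a).2 ⟨hxa, haz.trans hy.le⟩, haz⟩
    · rintro ⟨hy, a, ha, haz⟩
      exact ⟨((hA a).1 ha).1.lt.trans_le haz, hy⟩
  rw [h]
  obtain ⟨a, hxa, hay⟩ := exists_covBy_le_of_lt hxy
  exact hα.exactIn_above_atoms hd hk ⟨a, (hA a).2 ⟨hxa, hay⟩⟩ (fun a ha => ((hA a).1 ha).1)
    (fun a ha => ((hA a).1 ha).2)

end CohenMacaulay

end FinPoset

/-! ### Reduced homology and its rank -/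

namespace FinPoset

open CategoryTheory

section Homology

variable (K : Type*) [CommRing K] (α : Type*) [PartialOrder α]

theorem augmentedChainComplex_d (k : ℕ) :
    (augmentedChainComplex K α).d (k + 1) k = ModuleCat.ofHom (boundary K α k) :=
  ChainComplex.of_d (fun k => ModuleCat.of K ((Fin k ↪o α) →₀ K))
    (fun k => ModuleCat.ofHom (boundary K α k)) k

theorem augmentedChainComplex_d_pred (k : ℕ) :
    (augmentedChainComplex K α).d k (k - 1) = ModuleCat.ofHom (boundaryFrom K α k) := by
  cases k with
  | zero => exact (augmentedChainComplex K α).shape _ _ (by simp)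
  | succ k => exact augmentedChainComplex_d K α k

theorem next_down_nat (k : ℕ) : (ComplexShape.down ℕ).next k = k - 1 := by
  cases k <;> simp

variable {K α}

theorem subsingleton_reducedHomologyPred {k : ℕ}
    (h : ∀ x, boundaryFrom K α k x = 0 → ∃ y, boundary K α k y = x) :
    Subsingleton (reducedHomologyPred K α k) := by
  apply ModuleCat.subsingleton_of_isZero
  rw [← HomologicalComplex.exactAt_iff_isZero_homology,
    HomologicalComplex.exactAt_iff' _ (k + 1) k (k - 1) (by simp) (next_down_nat k),
    ShortComplex.moduleCat_exact_iff]
  intro x hx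
  have hg : ((augmentedChainComplex K α).sc' (k + 1) k (k - 1)).g.hom = boundaryFrom K α k :=
    congrArg ModuleCat.Hom.hom (augmentedChainComplex_d_pred K α k)
  have hf : ((augmentedChainComplex K α).sc' (k + 1) k (k - 1)).f.hom = boundary K α k :=
    congrArg ModuleCat.Hom.hom (augmentedChainComplex_d K α k)
  obtain ⟨y, hy⟩ := h x ((LinearMap.congr_fun hg x).symm.trans hx)
  exact ⟨y, (LinearMap.congr_fun hf y).trans hy⟩

/-- If there are no chains with `k + 1` elements, the homology in degree `k` consists of the
cycles. -/
theorem nonempty_linearEquiv_ker_boundaryFrom {k : ℕ} [IsEmpty (Fin (k + 1) ↪o α)] :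
    Nonempty (reducedHomologyPred K α k ≃ₗ[K] LinearMap.ker (boundaryFrom K α k)) := by
  let S := (augmentedChainComplex K α).sc' (k + 1) k (k - 1)
  have hg : S.g.hom = boundaryFrom K α k :=
    congrArg ModuleCat.Hom.hom (augmentedChainComplex_d_pred K α k)
  have hf : LinearMap.range S.moduleCatToCycles = ⊥ := by
    rw [LinearMap.range_eq_bot]
    have : Subsingleton S.X₁ := inferInstanceAs (Subsingleton ((Fin (k + 1) ↪o α) →₀ K))
    ext x
    rw [Subsingleton.elim x 0, map_zero, map_zero]
  exact ⟨((augmentedChainComplex K α).homologyIsoSc' (k + 1) k (k - 1) (by simp)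
    (next_down_nat k) ≪≫ S.moduleCatHomologyIso).toLinearEquiv ≪≫ₗ
    Submodule.quotEquivOfEqBot _ hf ≪≫ₗ LinearEquiv.ofEq _ _ (by rw [hg]; rfl)⟩

end Homology

section Subtype

variable {K : Type*} [CommRing K] {α : Type*} [PartialOrder α] {S : Set α}

theorem mapDomain_subtype_boundary (k : ℕ) (x : (Fin (k + 1) ↪o S) →₀ K) :
    (boundary K S k x).mapDomain (fun c => c.trans (OrderEmbedding.subtype (· ∈ S))) =
      boundary K α k (x.mapDomain fun c => c.trans (OrderEmbedding.subtype (· ∈ S))) := by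
  induction x using Finsupp.induction_linear with
  | zero => simp
  | add x y hx hy => rw [map_add, Finsupp.mapDomain_add, hx, hy, Finsupp.mapDomain_add, map_add]
  | single c r =>
    rw [boundary_single, Finsupp.mapDomain_finsetSum, Finsupp.mapDomain_single, boundary_single]
    simp only [Finsupp.mapDomain_single]
    rfl

theorem ExactIn.exists_boundary_eq {k : ℕ} (h : ExactIn K S k) (x : (Fin k ↪o S) →₀ K)
    (hx : boundaryFrom K S k x = 0) : ∃ y, boundary K S k y = x := by
  let e (k : ℕ) (c : Fin k ↪o S) : Fin k ↪o α := c.trans (OrderEmbedding.subtype (· ∈ S))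
  have he (k : ℕ) : Function.Injective (e k) := fun c c' hcc => by
    ext i
    exact DFunLike.congr_fun hcc i
  have hxS : x.mapDomain (e k) ∈ chainsIn K S k := by
    intro c hc i
    classical
    obtain ⟨c', -, rfl⟩ := Finset.mem_image.1 (Finsupp.mapDomain_support hc)
    exact (c' i).2
  have hx₀ : boundaryFrom K α k (x.mapDomain (e k)) = 0 := by
    cases k with
    | zero => rfl
    | succ k =>
      refine (mapDomain_subtype_boundary k x).symm.trans ?_
      rw [show boundary K S k x = 0 from hx, Finsupp.mapDomain_zero]
  obtain ⟨y, hyS, hy⟩ := h _ hxS hx₀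
  have hy' : (y.support : Set (Fin (k + 1) ↪o α)) ⊆ Set.range (e (k + 1)) := by
    intro c hc
    have hcS : ∀ i, c i ∈ S := (Finsupp.mem_supported K y).1 hyS hc
    exact ⟨OrderEmbedding.ofMapLEIff (fun i => ⟨c i, hcS i⟩) fun i j => c.le_iff_le, rfl⟩
  rw [← Finsupp.mapDomain_comapDomain _ (he (k + 1)) y hy', ← mapDomain_subtype_boundary] at hy
  exact ⟨_, Finsupp.mapDomain_injective (he k) hy⟩

end Subtype

section Rank

variable (K : Type*) [CommRing K] [IsDomain K] (α : Type*) [PartialOrder α] [Finite α]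

/-- The Euler–Poincaré formula up to a degree below which the complex is exact. -/
theorem finrank_ker_boundaryFrom {d : ℕ}
    (h : ∀ k < d, ∀ x, boundaryFrom K α k x = 0 → ∃ y, boundary K α k y = x) :
    (-1) ^ d * (Module.finrank K (LinearMap.ker (boundaryFrom K α d)) : ℤ) =
      ∑ k ∈ Finset.range (d + 1), (-1) ^ k * (Nat.card (Fin k ↪o α) : ℤ) := by
  have hfin (k : ℕ) : Finite (Fin k ↪o α) := Finite.of_injective _ DFunLike.coe_injective
  have hcard (k : ℕ) : Module.finrank K ((Fin k ↪o α) →₀ K) = Nat.card (Fin k ↪o α) := by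
    have := Fintype.ofFinite (Fin k ↪o α)
    rw [Module.finrank_finsupp_self, Nat.card_eq_fintype_card]
  induction d with
  | zero =>
    have h₀ : Module.finrank K (LinearMap.ker (boundaryFrom K α 0)) = Nat.card (Fin 0 ↪o α) := by
      rw [show LinearMap.ker (boundaryFrom K α 0) = ⊤ from LinearMap.ker_zero, finrank_top, hcard]
    simp [h₀]
  | succ d ih =>
    have h₁ := (LinearMap.ker (boundary K α d)).finrank_quotient_add_finrank
    rw [(boundary K α d).quotKerEquivRange.finrank_eq] at h₁
    have h₂ : LinearMap.range (boundary K α d) = LinearMap.ker (boundaryFrom K α d) :=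
      le_antisymm (by rintro _ ⟨y, rfl⟩; exact boundaryFrom_boundary K d y)
        fun x hx => h d (Nat.lt_succ_self d) x hx
    rw [h₂, hcard] at h₁
    rw [Finset.sum_range_succ, ← ih fun k hk => h k (hk.trans (Nat.lt_succ_self d)), ← h₁]
    have h₃ : Module.finrank K (LinearMap.ker (boundaryFrom K α (d + 1))) =
        Module.finrank K (LinearMap.ker (boundary K α d)) := rfl
    rw [h₃]
    push_cast
    ring

/-- If the chains of `α` have at most `d` elements and the augmented chain complex is exact below
degree `d`, the top homology is free and its rank is the reduced Euler characteristic up to sign. -/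
theorem free_and_rank_reducedHomologyPred [IsPrincipalIdealRing K] {d r : ℕ}
    [IsEmpty (Fin (d + 1) ↪o α)]
    (h : ∀ k < d, ∀ x, boundaryFrom K α k x = 0 → ∃ y, boundary K α k y = x)
    (hr : ∑ k ∈ Finset.range (d + 1), (-1) ^ k * (Nat.card (Fin k ↪o α) : ℤ) = (-1) ^ d * r) :
    Module.Free K (reducedHomologyPred K α d) ∧
      Module.rank K (reducedHomologyPred K α d) = r := by
  have hfin : Finite (Fin d ↪o α) := Finite.of_injective _ DFunLike.coe_injective
  obtain ⟨e⟩ := nonempty_linearEquiv_ker_boundaryFrom (K := K) (α := α) (k := d)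
  have : Module.Free K (LinearMap.ker (boundaryFrom K α d)) :=
    Module.Free.of_basis (Submodule.basisOfPid Finsupp.basisSingleOne _).2
  refine ⟨Module.Free.of_equiv e.symm, ?_⟩
  rw [e.rank_eq, ← Module.finrank_eq_rank, Nat.cast_inj]
  have h₁ := finrank_ker_boundaryFrom K α h
  rw [hr] at h₁
  exact_mod_cast mul_left_cancel₀ (pow_ne_zero d (by norm_num : (-1 : ℤ) ≠ 0)) h₁

end Rank

end FinPoset

/-! ### The length of an open interval -/

namespace FinPoset

section Height

variable {α : Type*} [PartialOrder α] [GradeOrder ℕ α]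

theorem chainHeight_Ioo [Finite α] {x y : α} {d : ℕ} (hxy : x < y)
    (hd : grade ℕ y = grade ℕ x + d + 1) : (Set.Ioo x y).chainHeight (· ≤ ·) = d := by
  apply le_antisymm
  · refine iSup_le fun ⟨t, ht, hchain⟩ => ?_
    have hinj : Set.InjOn (grade ℕ) t := fun a ha b hb hab => by
      by_contra hne
      rcases hchain ha hb hne with h | h
      · exact (grade_strictMono (𝕆 := ℕ) (h.lt_of_ne hne)).ne hab
      · exact (grade_strictMono (𝕆 := ℕ) (h.lt_of_ne' hne)).ne' hab
    rw [← hinj.encard_image]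
    have hsub : grade ℕ '' t ⊆ Set.Ioo (grade ℕ x) (grade ℕ y) := by
      rintro _ ⟨a, ha, rfl⟩
      exact ⟨grade_strictMono (ht ha).1, grade_strictMono (ht ha).2⟩
    refine (Set.encard_le_encard hsub).trans (le_of_eq ?_)
    rw [← Finset.coe_Ioo, Set.encard_coe_eq_coe_finsetCard, Nat.card_Ioo, Nat.cast_inj]
    omega
  · suffices H : ∃ t ⊆ Set.Ioo x y, IsChain (· ≤ ·) t ∧ t.encard = d by
      obtain ⟨t, ht, hchain, hcard⟩ := H
      exact hcard ▸ Set.encard_le_chainHeight_of_isChain _ t ht hchain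
    induction d generalizing x with
    | zero => exact ⟨∅, Set.empty_subset _, IsChain.empty, by simp⟩
    | succ d ih =>
      obtain ⟨a, hxa, hay⟩ := exists_covBy_le_of_lt hxy
      have hga := Nat.covBy_iff_add_one_eq.1 (hxa.grade ℕ)
      have hay' : a < y := hay.lt_of_ne fun h => by
        rw [h] at hga
        omega
      obtain ⟨t, ht, hchain, hcard⟩ := ih hay' (by omega)
      refine ⟨insert a t, Set.insert_subset ⟨hxa.lt, hay'⟩ fun b hb =>
        ⟨hxa.lt.trans (ht hb).1, (ht hb).2⟩, hchain.insert fun b hb _ => Or.inl (ht hb).1.le, ?_⟩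
      rw [Set.encard_insert_of_notMem fun h => (ht h).1.false, hcard]
      rfl

theorem isEmpty_chain_Ioo {x y : α} {d : ℕ} (hd : grade ℕ y = grade ℕ x + d + 1) :
    IsEmpty (Fin (d + 1) ↪o Set.Ioo x y) := by
  refine ⟨fun c => ?_⟩
  have hmem : ∀ i ∈ (Finset.univ : Finset (Fin (d + 1))),
      grade ℕ (c i : α) ∈ Finset.Ioo (grade ℕ x) (grade ℕ y) := fun i _ =>
    Finset.mem_Ioo.2 ⟨grade_strictMono (c i).2.1, grade_strictMono (c i).2.2⟩
  have hmono : StrictMono fun i => grade ℕ (c i : α) := fun i j hij =>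
    grade_strictMono (c.strictMono hij)
  have := Finset.card_le_card_of_injOn _ hmem hmono.injective.injOn
  rw [Finset.card_univ, Fintype.card_fin, Nat.card_Ioo] at this
  omega

end Height

/-! ### Möbius function and Philip Hall's theorem -/

section Moebius

variable {α : Type*} [PartialOrder α] [Finite α]

theorem moebius_self (x : α) : moebius α x x = 1 := by
  classical
  let : Fintype α := Fintype.ofFinite α
  let : LocallyFiniteOrder α := Fintype.toLocallyFiniteOrder
  exact IncidenceAlgebra.mu_self x

theorem moebius_eq_neg_sum_left {x y : α} (h : x ≠ y) (s : Finset α)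
    (hs : ∀ z, z ∈ s ↔ x ≤ z ∧ z < y) : moebius α x y = -∑ z ∈ s, moebius α x z := by
  classical
  let : Fintype α := Fintype.ofFinite α
  let : LocallyFiniteOrder α := Fintype.toLocallyFiniteOrder
  refine (IncidenceAlgebra.mu_eq_neg_sum_Ico_of_ne h).trans
    (congrArg _ (Finset.sum_congr ?_ fun _ _ => rfl))
  ext z
  rw [hs, Finset.mem_Ico]

theorem moebius_eq_neg_sum_right {x y : α} (h : x ≠ y) (s : Finset α)
    (hs : ∀ z, z ∈ s ↔ x < z ∧ z ≤ y) : moebius α x y = -∑ z ∈ s, moebius α z y := by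
  classical
  let : Fintype α := Fintype.ofFinite α
  let : LocallyFiniteOrder α := Fintype.toLocallyFiniteOrder
  refine (IncidenceAlgebra.mu_eq_neg_sum_Ioc_of_ne h).trans
    (congrArg _ (Finset.sum_congr ?_ fun _ _ => rfl))
  ext z
  rw [hs, Finset.mem_Ioc]

/-- A nonempty chain in `(x, y)` is its least element `z` followed by a chain in `(z, y)`. -/
def chainIooEquiv {α : Type*} [PartialOrder α] (x y : α) (k : ℕ) :
    (Fin (k + 1) ↪o Set.Ioo x y) ≃ Σ z : Set.Ioo x y, Fin k ↪o Set.Ioo (z : α) y where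
  toFun c := ⟨c 0, OrderEmbedding.ofStrictMono
    (fun i => ⟨c i.succ, c.strictMono (Fin.succ_pos i), (c i.succ).2.2⟩)
    fun _ _ h => c.strictMono (Fin.succ_lt_succ_iff.2 h)⟩
  invFun p := consChain p.1 (OrderEmbedding.ofStrictMono
    (fun i => (⟨p.2 i, p.1.2.1.trans (p.2 i).2.1, (p.2 i).2.2⟩ : Set.Ioo x y))
    fun _ _ h => p.2.strictMono h) fun i => (p.2 i).2.1
  left_inv c := by
    ext i
    induction i using Fin.cases <;> rfl
  right_inv p := rfl

/-- Philip Hall's theorem: the Möbius number of an interval is the reduced Euler characteristic of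
the order complex of its interior. -/
theorem sum_card_chain_eq_neg_moebius [GradeOrder ℕ α] (N : ℕ) {x y : α} (hxy : x < y)
    (hN : grade ℕ y ≤ grade ℕ x + N) :
    ∑ k ∈ Finset.range N, (-1) ^ k * (Nat.card (Fin k ↪o Set.Ioo x y) : ℤ) =
      -moebius α x y := by
  have := Fintype.ofFinite (Set.Ioo x y)
  induction N generalizing x with
  | zero => exact absurd (grade_strictMono (𝕆 := ℕ) hxy) (not_lt.2 hN)
  | succ N ih =>
    have h₀ : Nat.card (Fin 0 ↪o Set.Ioo x y) = 1 := by
      have : Subsingleton (Fin 0 ↪o Set.Ioo x y) := ⟨fun c c' => by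
        ext i
        exact i.elim0⟩
      have : Nonempty (Fin 0 ↪o Set.Ioo x y) :=
        ⟨OrderEmbedding.ofStrictMono (fun i => i.elim0) fun i => i.elim0⟩
      exact Nat.card_unique
    have h₁ (k : ℕ) : (Nat.card (Fin (k + 1) ↪o Set.Ioo x y) : ℤ) =
        ∑ z : Set.Ioo x y, (Nat.card (Fin k ↪o Set.Ioo (z : α) y) : ℤ) := by
      have (z : Set.Ioo x y) : Finite (Fin k ↪o Set.Ioo (z : α) y) :=
        Finite.of_injective _ DFunLike.coe_injective
      rw [Nat.card_congr (chainIooEquiv x y k), Nat.card_sigma, Nat.cast_sum]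
    have h₂ (z : Set.Ioo x y) := ih z.2.2 (by
      have := grade_strictMono (𝕆 := ℕ) z.2.1
      omega) (Fintype.ofFinite _)
    rw [moebius_eq_neg_sum_right hxy.ne (Finset.cons y (Set.Ioo x y).toFinset (by simp))
        fun z => ?_, Finset.sum_cons, moebius_self, neg_neg, Finset.sum_range_succ', h₀, add_comm,
      ← Finset.sum_set_coe]
    · simp only [h₁, Finset.mul_sum]
      rw [Finset.sum_comm]
      refine congrArg₂ _ (by simp) (Finset.sum_congr rfl fun z _ => ?_)
      rw [← neg_inj, ← h₂ z, ← Finset.sum_neg_distrib]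
      exact Finset.sum_congr rfl fun k _ => by ring
    · rw [Finset.mem_cons, Set.mem_toFinset, Set.mem_Ioo]
      constructor
      · rintro (rfl | ⟨h, h'⟩)
        exacts [⟨hxy, le_rfl⟩, ⟨h, h'.le⟩]
      · rintro ⟨h, h'⟩
        exact h'.eq_or_lt.imp id fun h' => ⟨h, h'⟩

theorem moebius_coe (x y : α) : moebius (WithTop α) x y = moebius α x y := by
  induction y using (wellFounded_lt (α := α)).induction with
  | _ y ih =>
  by_cases h : x = y
  · rw [h, moebius_self, moebius_self]
  · let s : Finset α := (Set.toFinite (Set.Ico x y)).toFinset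
    have hs : ∀ z, z ∈ s ↔ x ≤ z ∧ z < y := fun z => Set.Finite.mem_toFinset _
    rw [moebius_eq_neg_sum_left h s hs, moebius_eq_neg_sum_left (by simpa using h)
      (s.map ⟨WithTop.some, WithTop.coe_injective⟩) fun z => ?_, Finset.sum_map]
    · exact congrArg _ (Finset.sum_congr rfl fun z hz => ih z ((hs z).1 hz).2)
    · induction z using WithTop.recTopCoe <;> simp [hs]

variable (α) in
theorem moebius_bot_top [OrderBot α] :
    moebius (WithTop α) ⊥ ⊤ = -(charPoly α).eval 1 := by
  let : Fintype α := Fintype.ofFinite α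
  rw [moebius_eq_neg_sum_left bot_ne_top (Finset.univ.map ⟨WithTop.some, WithTop.coe_injective⟩)
      fun z => ?_, Finset.sum_map, charPoly, Polynomial.eval_finsetSum]
  · simpa using Finset.sum_congr rfl fun z _ => moebius_coe ⊥ z
  · induction z using WithTop.recTopCoe <;> simp

end Moebius

end FinPoset

/-! ### The Möbius number of the pointed partition poset -/

/-- An alternating sum of values of a polynomial of degree less than `m + 1` vanishes. -/
theorem sum_alternating_choose_mul_pow (m : ℕ) :
    ∑ j ∈ Finset.range (m + 2), (-1 : ℤ) ^ j * (m + 1).choose j * ((j : ℤ) - 1) ^ m = 0 := by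
  have h := congrFun (fwdDiff_iter_pow_eq_zero_of_lt (R := ℤ) (Nat.lt_succ_self m)) (-1)
  rw [fwdDiff_iter_eq_sum_shift] at h
  have h₂ : ((-1 : ℤ) ^ (m + 1)) ≠ 0 := pow_ne_zero _ (by norm_num)
  apply mul_left_cancel₀ h₂
  rw [mul_zero, Finset.mul_sum]
  refine (Finset.sum_congr rfl fun j hj => ?_).trans h
  have hj' : j ≤ m + 1 := Nat.lt_succ_iff.1 (Finset.mem_range.1 hj)
  have hs : (-1 : ℤ) ^ (m + 1) * (-1) ^ j = (-1) ^ (m + 1 - j) := by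
    obtain ⟨i, hi⟩ := Nat.exists_eq_add_of_le hj'
    rw [hi, Nat.add_sub_cancel_left, pow_add, mul_right_comm, ← mul_pow]
    simp
  rw [← mul_assoc, ← mul_assoc, hs, smul_eq_mul, nsmul_eq_mul, mul_one, neg_add_eq_sub,
    Nat.succ_eq_add_one]

/-- The case `x = -1`, `y = 0` of Abel's identity
`∑ j, (k.choose j) * x * (x + j) ^ (j - 1) * (y - j) ^ (k - j) = (x + y) ^ k`. -/
theorem sum_choose_mul_pow_mul_pow {k : ℕ} (hk : k ≠ 0) :
    ∑ j ∈ Finset.range (k + 1),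
      (k.choose j : ℤ) * (j ^ (k - j) * ((-1) ^ j * ((j - 1 : ℕ) : ℤ) ^ (j - 1))) = -1 := by
  -- Expand `j ^ (k - j) = ((j - 1) + 1) ^ (k - j)` by the binomial theorem.
  have hexp : ∀ j ∈ Finset.range k, (k.choose (j + 1) : ℤ) *
      ((j + 1 : ℕ) ^ (k - (j + 1)) * ((-1) ^ (j + 1) * ((j + 1 - 1 : ℕ) : ℤ) ^ (j + 1 - 1))) =
      ∑ i ∈ Finset.range k, (k.choose i : ℤ) *
        ((-1) ^ (j + 1) * (k - i).choose (j + 1) * (j : ℤ) ^ (k - 1 - i)) := by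
    intro j hj
    have hjk := Finset.mem_range.1 hj
    rw [Nat.cast_add, Nat.cast_one, add_pow, Nat.add_sub_cancel, Finset.sum_mul, Finset.mul_sum]
    rw [← Finset.sum_subset (Finset.range_subset_range.2 (by omega : k - (j + 1) + 1 ≤ k))]
    · rw [← Finset.sum_flip]
      refine Finset.sum_congr rfl fun i hi => ?_
      have hi' : i ≤ k - (j + 1) := Nat.lt_succ_iff.1 (Finset.mem_range.1 hi)
      have h₁ : (j : ℤ) ^ (k - 1 - i) = j ^ (k - (j + 1) - i) * j ^ j := by
        rw [← pow_add]
        congr 1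
        omega
      have h₂ : (k.choose (j + 1) : ℤ) * (k - (j + 1)).choose i =
          k.choose i * (k - i).choose (j + 1) := by
        have h := Nat.choose_mul (n := k) (k := i + (j + 1)) (s := i) (by omega)
        have h' := Nat.choose_mul (n := k) (k := i + (j + 1)) (s := j + 1) (by omega)
        rw [Nat.add_sub_cancel_left] at h
        rw [Nat.add_sub_cancel] at h'
        have h'' : (i + (j + 1)).choose i = (i + (j + 1)).choose (j + 1) := Nat.choose_symm_add
        rw [h'', h'] at h
        exact_mod_cast h
      rw [h₁, one_pow, mul_one, Nat.choose_symm hi']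
      linear_combination ((j : ℤ) ^ (k - (j + 1) - i) * j ^ j * (-1) ^ (j + 1)) * h₂
    · intro i _ hi
      rw [Nat.choose_eq_zero_of_lt (n := k - i)]
      · simp
      · simp only [Finset.mem_range] at hi
        omega
  have hinner : ∀ i ∈ Finset.range k, ∑ j ∈ Finset.range k,
      (-1 : ℤ) ^ (j + 1) * (k - i).choose (j + 1) * (j : ℤ) ^ (k - 1 - i) = (-1) ^ (k - i) := by
    intro i hi
    have hik := Finset.mem_range.1 hi
    obtain ⟨m, hm⟩ : ∃ m, k - i = m + 1 := ⟨k - i - 1, by omega⟩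
    have h := sum_alternating_choose_mul_pow m
    rw [Finset.sum_range_succ'] at h
    rw [hm, (by omega : k - 1 - i = m),
      ← Finset.sum_subset (Finset.range_subset_range.2 (by omega : m + 1 ≤ k))]
    · have h₁ := eq_neg_of_add_eq_zero_left h
      simp only [Nat.cast_add, Nat.cast_one, add_sub_cancel_right] at h₁
      rw [h₁]
      simp [pow_succ]
    · intro j _ hj
      rw [Nat.choose_eq_zero_of_lt (n := m + 1)]
      · simp
      · simp only [Finset.mem_range] at hj
        omega
  rw [Finset.sum_range_succ', Finset.sum_congr rfl hexp, Finset.sum_comm,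
    Finset.sum_congr rfl fun i hi => by rw [← Finset.mul_sum, hinner i hi]]
  have h := add_pow (1 : ℤ) (-1) k
  rw [Finset.sum_range_succ] at h
  simp only [one_pow, one_mul, add_neg_cancel, zero_pow hk, Nat.sub_self, pow_zero,
    Nat.choose_self, Nat.cast_one] at h
  simp only [Nat.choose_zero_right, Nat.cast_zero, Nat.sub_zero, zero_pow hk, zero_mul, mul_zero,
    add_zero]
  rw [eq_neg_iff_add_eq_zero, h]
  simp only [mul_comm]

namespace PointedPartition

variable {n : ℕ}

theorem ncard_points_pos (hn : 1 ≤ n) (π : PointedPartition n) : 0 < π.points.ncard :=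
  (Set.ncard_pos (Set.toFinite _)).2 ⟨_, π.point_mem ⟨0, hn⟩⟩

/-- A pointed partition above `π` with set of points `S` is determined by the points of `S` to
which it sends the other points of `π`. -/
noncomputable def aboveEquiv (π : PointedPartition n) {S : Set (Fin n)} (hS : S ⊆ π.points) :
    {ν // π ≤ ν ∧ ν.points = S} ≃ (↥(π.points \ S) → S) where
  toFun ν x := ⟨ν.1.point x, (Set.ext_iff.1 ν.2.2 _).1 (ν.1.point_mem x)⟩
  invFun h := by
    classical
    let g : Fin n → Fin n := fun x =>
      if hx : π.point x ∈ S then π.point x else h ⟨π.point x, π.point_mem x, hx⟩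
    have hgS : ∀ x, g x ∈ S := fun x => by
      by_cases hx : π.point x ∈ S
      · simp only [g, dif_pos hx, hx]
      · simp only [g, dif_neg hx, Subtype.coe_prop]
    have hg : ∀ x ∈ S, g x = x := fun x hx => by
      have h₁ := π.point_eq_self_iff.2 (hS hx)
      simp only [g, h₁, dif_pos hx]
    refine ⟨ofIdempotent g fun x => hg _ (hgS x), le_iff_point.2 fun x => ?_, Set.ext fun x => ?_⟩
    · rw [point_ofIdempotent, point_ofIdempotent]
      exact ⟨by simp only [g, point_point], π.point_eq_self_iff.2 (hS (hgS x))⟩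
    · rw [← point_eq_self_iff, point_ofIdempotent]
      exact ⟨fun hx => hx ▸ hgS x, hg x⟩
  left_inv ν := by
    obtain ⟨ν, hle, rfl⟩ := ν
    refine Subtype.ext (ext_point fun x => ?_)
    rw [point_ofIdempotent]
    have h := (le_iff_point.1 hle x).1
    by_cases hx : π.point x ∈ ν.points
    · simp only [dif_pos hx, ← h, ν.point_eq_self_iff.2 hx]
    · simp only [dif_neg hx, h]
  right_inv h := by
    funext x
    have h₁ := π.point_eq_self_iff.2 x.2.1
    have h₂ : π.point x ∉ S := h₁.symm ▸ x.2.2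
    refine Subtype.ext ?_
    simp only [point_ofIdempotent, dif_neg h₂]
    exact congrArg (fun z => (h z : Fin n)) (Subtype.ext h₁)

theorem card_above (π : PointedPartition n) {S : Set (Fin n)} (hS : S ⊆ π.points) :
    Nat.card {ν // π ≤ ν ∧ ν.points = S} = S.ncard ^ (π.points.ncard - S.ncard) := by
  rw [Nat.card_congr (π.aboveEquiv hS), Nat.card_fun, Nat.card_coe_set_eq, Nat.card_coe_set_eq,
    Set.ncard_sdiff hS (Set.toFinite _)]

/-- Summation over the pointed partitions above `π` according to their points. -/
theorem sum_above (π : PointedPartition n) (s : Finset (PointedPartition n))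
    (hs : ∀ ν, ν ∈ s ↔ π ≤ ν) (F : ℕ → ℤ) :
    ∑ ν ∈ s, F ν.points.ncard = ∑ j ∈ Finset.range (π.points.ncard + 1),
      (π.points.ncard.choose j : ℤ) * (j ^ (π.points.ncard - j) * F j) := by
  classical
  let p (ν : PointedPartition n) : Finset (Fin n) := (Set.toFinite ν.points).toFinset
  have hp (ν : PointedPartition n) : (p ν : Set (Fin n)) = ν.points := Set.Finite.coe_toFinset _
  have hcard (ν : PointedPartition n) : ν.points.ncard = (p ν).card := by
    rw [← hp, Set.ncard_coe_finset]
  have hmaps : ∀ ν ∈ s, p ν ∈ (p π).powerset := fun ν hν => by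
    rw [Finset.mem_powerset, ← Finset.coe_subset, hp, hp]
    exact ((hs ν).1 hν).2
  rw [← Finset.sum_fiberwise_of_maps_to hmaps, hcard π]
  have hfib : ∀ S ∈ (p π).powerset, ∑ ν ∈ s with p ν = S, F ν.points.ncard =
      (S.card : ℤ) ^ ((p π).card - S.card) * F S.card := by
    intro S hS
    rw [Finset.mem_powerset, ← Finset.coe_subset, hp] at hS
    rw [Finset.sum_congr rfl fun ν hν => by rw [hcard, (Finset.mem_filter.1 hν).2],
      Finset.sum_const, nsmul_eq_mul]
    congr 1
    have h := π.card_above hS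
    rw [Set.ncard_coe_finset, hcard π] at h
    rw [← Nat.cast_pow, ← h, Nat.cast_inj, Nat.subtype_card]
    intro ν
    rw [Finset.mem_filter, hs, ← hp ν, Finset.coe_inj]
  rw [Finset.sum_congr rfl hfib,
    Finset.sum_powerset_apply_card fun j => (j : ℤ) ^ ((p π).card - j) * F j]
  simp only [nsmul_eq_mul]

end PointedPartition

/-- By downward induction, since both sides satisfy the recursion `∑ z ∈ [π, ⊤], μ(z, ⊤) = 0`. -/
theorem ExtendedPointedPartition.moebius_coe_top {n : ℕ} (hn : 1 ≤ n) (π : PointedPartition n) :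
    FinPoset.moebius (ExtendedPointedPartition n) π ⊤ =
      (-1) ^ π.points.ncard * ((π.points.ncard - 1 : ℕ) : ℤ) ^ (π.points.ncard - 1) := by
  classical
  have := Fintype.ofFinite (PointedPartition n)
  induction π using (wellFounded_gt (α := PointedPartition n)).induction with
  | _ π ih =>
  let s : Finset (PointedPartition n) := Finset.univ.filter fun ν => π < ν
  have hs : ∀ ν, ν ∈ s ↔ π < ν := by simp [s]
  have hsum := π.sum_above (Finset.cons π s (by simp [s])) (fun ν => by
    rw [Finset.mem_cons, hs, le_iff_eq_or_lt, eq_comm])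
    fun k => (-1) ^ k * ((k - 1 : ℕ) : ℤ) ^ (k - 1)
  rw [sum_choose_mul_pow_mul_pow (π.ncard_points_pos hn).ne', Finset.sum_cons] at hsum
  rw [FinPoset.moebius_eq_neg_sum_right (WithTop.coe_ne_top)
    (Finset.cons ⊤ (s.map ⟨WithTop.some, WithTop.coe_injective⟩) (by simp)) fun z => ?_,
    Finset.sum_cons, Finset.sum_map, FinPoset.moebius_self]
  · have h₁ : ∑ ν ∈ s, FinPoset.moebius (ExtendedPointedPartition n) ν ⊤ = _ :=
      Finset.sum_congr rfl fun ν hν => ih ν ((hs ν).1 hν)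
    simp only [Function.Embedding.coeFn_mk]
    rw [h₁]
    linear_combination -hsum
  · induction z using WithTop.recTopCoe <;> simp [hs]

/-! ### The extended pointed partition poset -/

namespace FinPoset

theorem IsTotallySemimodular.isCohenMacaulay {α : Type*} [PartialOrder α] [BoundedOrder α]
    [Finite α] [GradeOrder ℕ α] (hα : IsTotallySemimodular α) (K : Type*) [CommRing K] :
    IsCohenMacaulay K α := by
  intro x y hxy k hk
  obtain ⟨d, hd⟩ := Nat.exists_eq_add_of_lt (grade_strictMono (𝕆 := ℕ) hxy)
  rw [chainHeight_Ioo hxy hd, ne_eq, Nat.cast_inj] at hk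
  exact subsingleton_reducedHomologyPred (hα.exactIn_Ioo hd hxy hk).exists_boundary_eq

end FinPoset

theorem ExtendedPointedPartition.grade_top {n : ℕ} (hn : 1 ≤ n) :
    grade ℕ (⊤ : ExtendedPointedPartition n) =
      grade ℕ (⊥ : ExtendedPointedPartition n) + (n - 1) + 1 := by
  have h : (⊥ : PointedPartition n).points.ncard = n :=
    (Set.ncard_univ _).trans (Nat.card_fin n)
  change n - 1 + 1 = n - (⊥ : PointedPartition n).points.ncard + (n - 1) + 1
  omega

theorem mainTheorem8 (n : ℕ) (hn : 1 ≤ n) :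
    FinPoset.IsTotallySemimodular (ExtendedPointedPartition n) ∧
    FinPoset.IsCLShellable (ExtendedPointedPartition n) ∧
    (∀ (K : Type*) [CommRing K], (IsField K ∨ Nonempty (K ≃+* ℤ)) →
      FinPoset.IsCohenMacaulay K (ExtendedPointedPartition n) ∧
      -- homology of the proper part: dimension `k - 1` sits in degree `k`, the top one is `n - 2`
      (∀ k : ℕ, k ≠ n - 1 → Subsingleton (FinPoset.reducedHomologyPred K
        (Set.Ioo (⊥ : ExtendedPointedPartition n) ⊤) k)) ∧
      Module.Free K (FinPoset.reducedHomologyPred K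
        (Set.Ioo (⊥ : ExtendedPointedPartition n) ⊤) (n - 1)) ∧
      Module.rank K (FinPoset.reducedHomologyPred K
        (Set.Ioo (⊥ : ExtendedPointedPartition n) ⊤) (n - 1)) = (((n - 1) ^ (n - 1) : ℕ) : Cardinal)) ∧
    (Set.Ioo (⊥ : ExtendedPointedPartition n) ⊤).chainHeight (· ≤ ·) = ((n - 1 : ℕ) : ℕ∞) ∧
    FinPoset.moebius (ExtendedPointedPartition n) ⊥ ⊤ =
      -(FinPoset.charPoly (PointedPartition n)).eval 1 ∧
    (((n - 1) ^ (n - 1) : ℕ) : ℤ) =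
      (-1) ^ n * FinPoset.moebius (ExtendedPointedPartition n) ⊥ ⊤ := by
  have hsm := ExtendedPointedPartition.isTotallySemimodular n
  have hgrade := ExtendedPointedPartition.grade_top hn
  have hlt : (⊥ : ExtendedPointedPartition n) < ⊤ := bot_lt_top
  have hmu : FinPoset.moebius (ExtendedPointedPartition n) ⊥ ⊤ =
      (-1) ^ n * (((n - 1) ^ (n - 1) : ℕ) : ℤ) := by
    have h := ExtendedPointedPartition.moebius_coe_top hn ⊥
    have hbot : (⊥ : PointedPartition n).points.ncard = n :=
      (Set.ncard_univ _).trans (Nat.card_fin n)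
    rw [hbot] at h
    rw [Nat.cast_pow]
    exact h
  refine ⟨hsm, hsm.isCLShellable, fun K _ hK => ?_, FinPoset.chainHeight_Ioo hlt hgrade,
    FinPoset.moebius_bot_top _, ?_⟩
  · have hexact : ∀ k, k ≠ n - 1 → _ := fun k hk =>
      (hsm.exactIn_Ioo (K := K) hgrade hlt hk).exists_boundary_eq
    have hK' : IsDomain K ∧ IsPrincipalIdealRing K := by
      rcases hK with hK | ⟨⟨e⟩⟩
      · let := hK.toField
        exact ⟨inferInstance, inferInstance⟩
      · exact ⟨e.toMulEquiv.isDomain ℤ, IsPrincipalIdealRing.of_surjective e.symm.toRingHom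
          e.symm.surjective⟩
    obtain ⟨_, _⟩ := hK'
    have := FinPoset.isEmpty_chain_Ioo hgrade
    refine ⟨hsm.isCohenMacaulay K,
      fun k hk => FinPoset.subsingleton_reducedHomologyPred (hexact k hk),
      FinPoset.free_and_rank_reducedHomologyPred K _ (fun k hk => hexact k hk.ne) ?_⟩
    rw [FinPoset.sum_card_chain_eq_neg_moebius _ hlt (by omega), hmu]
    obtain ⟨m, rfl⟩ := Nat.exists_eq_add_of_le' hn
    simp [pow_succ]
  · rw [hmu, ← mul_assoc, ← mul_pow]
    simp
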